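/- **Setting.** Graphs are finite, simple, undirected, on $n$ labelled vertices. For a graph $G=(V,E)$, $|V|=n$, let $\mathrm{Av}=\mathrm{Av}(G)=2|E|/n$, $p_G(k)=|\{v:\deg_v=k\}|/n$ for $k\ge 0$, and $P_G(x)=|\{v:\deg_v\ge x\}|/n$. For $\alpha>1$, $G$ has *$\alpha$-decay* if $P_G(t\,\mathrm{Av})\le t^{-\alpha}$ for all real $t>1$. **Extended histogram.** For a natural number $D$, the flow graph of $G$ has vertices $s,t$ and two copies $v_\ell,v_r$ of each $v\in V$, edges $(s,v_\ell)$ and $(v_r,t)$ of capacity $D$, and edges $(u_\ell,v_r)$ of capacity $1$ for all ordered pairs $(u,v)$ with $uv\in E$. Let $f$ be a feasible real $s$–$t$ flow minimizing $\sum_v (D-f(s,v_\ell))^2+(D-f(v_r,t))^2$, and let $\hat f_D(G)$ be the list of the values $f(s,v_\ell)$ in nonincreasing order (it does not depend on the choice of $f$). Let $\text{deg-list}(G)$ be the list of degrees in nonincreasing order. For a list $a=(a_1,\dots,a_n)\in[0,D]^n$ put $H_k(a)=\sum_i\max\{0,\min\{1,a_i-(k-1)\}\}$, so $H_0(a)=n$,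 and $\mathrm{hist}_D(a)=H_D(a)$, $\mathrm{hist}_k(a)=H_k(a)-H_{k+1}(a)$ for $0\le k<D$. **Algorithm $\mathcal A_{combo}$** (parameters $\epsilon>0$, $\beta\in(0,1)$, $b>0$). 1. Let the candidate thresholds be $D_i=2^i$, $0\le i\le\lfloor\log_2 n\rfloor$, let $k=\lfloor\log_2 n\rfloor+1$ be their number, $q_i=\|\hat f_{D_i}(G)-\text{deg-list}(G)\|_1+6D_i^2/\epsilon$, $\tau=2\ln(k/\beta)/\epsilon$, and $s(i)=\max_j\frac{(q_i+\tau D_i)-(q_j+\tau D_j)}{D_i+D_j}$. Choose $\hat D=D_i$ with probability proportional to $\exp(-\epsilon s(i)/2)$ (the generalized exponential mechanism). 2. Let $\hat h(k)=\mathrm{hist}_k(\hat f_{\hat D}(G))+Y_k$ for $0\le k\le\hat D$, where the $Y_k$ are independent Laplace variables with density $\frac1{2\lambda}e^{-|z|/\lambda}$, $\lambda=b\hat D/\epsilon$, and $\hat h(k)=0$ for $k>\hat D$. 3. Output $\hat p=\hat h/\|\hat h\|_1$. **Theorem.** Fix $\alpha>1$, $\beta\in(0,1)$ and $b>0$. (1)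 There is a constant $C=C(\alpha,\beta,b)$ such that for all $n\ge 3$, all $0<\epsilon\le n$ and every $n$-vertex graph $G$ with $\alpha$-decay, $$\mathbb E\|\hat p-p_G\|_1\le C\,\frac{\mathrm{Av}^{\frac{2\alpha}{\alpha+1}}\,\ln\ln n}{(\epsilon n)^{\frac{\alpha-1}{\alpha+1}}}.$$ (2) Let $(G_m)$ be graphs with $\alpha$-decay on $n_m\to\infty$ vertices, and let $\epsilon_m>0$ satisfy $\epsilon_m\le n_m$ for all large $m$ and $(\ln\ln n_m)^2=O(\epsilon_m n_m)$ (for instance, $\epsilon_m=\epsilon>0$ constant). If $\mathrm{Av}(G_m)^{\frac{2\alpha}{\alpha-1}}=o(\epsilon_m n_m)$, then $\mathbb E\|\hat p-p_{G_m}\|_1\to0$. -/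

import Mathlib

open MeasureTheory ProbabilityTheory Filter Topology Asymptotics
open scoped ENNReal

namespace NodeDP

noncomputable section

/-! ### Degrees, degree distribution, decay -/

open scoped Classical in
/-- The degree of the vertex `v` of `G`. -/
def deg {n : ℕ} (G : SimpleGraph (Fin n)) (v : Fin n) : ℕ := G.degree v

open scoped Classical in
/-- The average degree `2|E| / |V|`. -/
def avgDeg {n : ℕ} (G : SimpleGraph (Fin n)) : ℝ := 2 * (G.edgeFinset.card : ℝ) / n

/-- The degree distribution: `degDist G k` is the fraction of vertices of degree exactly `k`. -/
def degDist {n : ℕ} (G : SimpleGraph (Fin n)) (k : ℕ) : ℝ :=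
  ((Finset.univ.filter fun v => deg G v = k).card : ℝ) / n

/-- The cumulative degree distribution: `cumDist G x` is the fraction of vertices of degree at
least `x`. -/
def cumDist {n : ℕ} (G : SimpleGraph (Fin n)) (x : ℝ) : ℝ :=
  ((Finset.univ.filter fun v => x ≤ (deg G v : ℝ)).card : ℝ) / n

/-- `α`-decay of a graph. -/
def AlphaDecay {n : ℕ} (α : ℝ) (G : SimpleGraph (Fin n)) : Prop :=
  ∀ t : ℝ, 1 < t → cumDist G (t * avgDeg G) ≤ t ^ (-α)

/-! ### Sorted lists -/

/-- The entries of `a`, sorted in nonincreasing order. -/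
def sortDesc {n : ℕ} (a : Fin n → ℝ) : Fin n → ℝ := fun i => a (Tuple.sort (fun j => -a j) i)

/-- The degrees of `G`, sorted in nonincreasing order. -/
def degList {n : ℕ} (G : SimpleGraph (Fin n)) : Fin n → ℝ := sortDesc fun v => (deg G v : ℝ)

/-! ### The flow graph and the extension of the degree list -/

/-- A real assignment to the edges of the flow graph on `s`, `t` and the left and right copies of
the vertices: `f.1 v` is the value on the edge from `s` to `v_ℓ`, `f.2.1 u v` the value on the edge
from `u_ℓ` to `v_r`, and `f.2.2 v` the value on the edge from `v_r` to `t`. -/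
abbrev EdgeValues (n : ℕ) : Type := (Fin n → ℝ) × (Fin n → Fin n → ℝ) × (Fin n → ℝ)

open scoped Classical in
/-- Feasible flows in the flow graph of `G` with threshold `D`: source and sink edges have capacity
`D`, the edge from `u_ℓ` to `v_r` has capacity one if `uv` is an edge of `G` and is absent
(capacity zero) otherwise, and flow is conserved at all left and right copies. -/
structure IsFlow {n : ℕ} (G : SimpleGraph (Fin n)) (D : ℕ) (f : EdgeValues n) : Prop where
  src_nonneg : ∀ v, 0 ≤ f.1 v
  src_le : ∀ v, f.1 v ≤ D
  mid_nonneg : ∀ u v, 0 ≤ f.2.1 u v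
  mid_le : ∀ u v, f.2.1 u v ≤ if G.Adj u v then 1 else 0
  snk_nonneg : ∀ v, 0 ≤ f.2.2 v
  snk_le : ∀ v, f.2.2 v ≤ D
  conserve_left : ∀ u, f.1 u = ∑ v, f.2.1 u v
  conserve_right : ∀ v, ∑ u, f.2.1 u v = f.2.2 v

/-- The objective: the squared Euclidean distance between the vector of all flows on source and
sink edges and the constant vector `D`. -/
def flowCost {n : ℕ} (D : ℕ) (f : EdgeValues n) : ℝ :=
  ∑ v, (((D : ℝ) - f.1 v) ^ 2 + ((D : ℝ) - f.2.2 v) ^ 2)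

/-- Feasible flows that minimize the objective. -/
def IsOptFlow {n : ℕ} (G : SimpleGraph (Fin n)) (D : ℕ) (f : EdgeValues n) : Prop :=
  IsFlow G D f ∧ ∀ g, IsFlow G D g → flowCost D f ≤ flowCost D g

theorem exists_isOptFlow {n : ℕ} (G : SimpleGraph (Fin n)) (D : ℕ) : ∃ f, IsOptFlow G D f := by
  classical
  have hne : IsFlow G D (0 : EdgeValues n) := by
    constructor <;> intros <;> simp
    split_ifs <;> norm_num
  have hsub : {f | IsFlow G D f} ⊆
      Set.Icc (0 : EdgeValues n) ((fun _ => (D : ℝ)), (fun _ _ => 1), (fun _ => (D : ℝ))) := by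
    intro f hf
    refine ⟨⟨fun v => hf.src_nonneg v, fun u v => hf.mid_nonneg u v, fun v => hf.snk_nonneg v⟩,
      ⟨fun v => hf.src_le v, fun u v => (hf.mid_le u v).trans ?_, fun v => hf.snk_le v⟩⟩
    split_ifs <;> norm_num
  have hclosed : IsClosed {f | IsFlow G D f} := by
    have : {f : EdgeValues n | IsFlow G D f} =
        {f | (∀ v, 0 ≤ f.1 v) ∧ (∀ v, f.1 v ≤ (D : ℝ)) ∧ (∀ u v, 0 ≤ f.2.1 u v) ∧
          (∀ u v, f.2.1 u v ≤ if G.Adj u v then 1 else 0) ∧ (∀ v, 0 ≤ f.2.2 v) ∧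
          (∀ v, f.2.2 v ≤ (D : ℝ)) ∧ (∀ u, f.1 u = ∑ v, f.2.1 u v) ∧
          (∀ v, ∑ u, f.2.1 u v = f.2.2 v)} := by
      ext f
      exact ⟨fun ⟨a, b, c, d, e, g, h, i⟩ => ⟨a, b, c, fun u v => by convert d u v, e, g, h, i⟩,
        fun ⟨a, b, c, d, e, g, h, i⟩ => ⟨a, b, c, fun u v => by convert d u v, e, g, h, i⟩⟩
    rw [this]
    simp only [Set.ofPred_and, Set.ofPred_forall]
    refine IsClosed.inter (isClosed_iInter fun v => isClosed_le (by fun_prop) (by fun_prop)) ?_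
    refine IsClosed.inter (isClosed_iInter fun v => isClosed_le (by fun_prop) (by fun_prop)) ?_
    refine IsClosed.inter (isClosed_iInter fun u => isClosed_iInter fun v =>
      isClosed_le (by fun_prop) (by fun_prop)) ?_
    refine IsClosed.inter (isClosed_iInter fun u => isClosed_iInter fun v =>
      isClosed_le (by fun_prop) (by fun_prop)) ?_
    refine IsClosed.inter (isClosed_iInter fun v => isClosed_le (by fun_prop) (by fun_prop)) ?_
    refine IsClosed.inter (isClosed_iInter fun v => isClosed_le (by fun_prop) (by fun_prop)) ?_
    exact IsClosed.inter (isClosed_iInter fun v => isClosed_eq (by fun_prop) (by fun_prop))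
      (isClosed_iInter fun v => isClosed_eq (by fun_prop) (by fun_prop))
  have hcont : Continuous (flowCost (n := n) D) := by
    unfold flowCost
    fun_prop
  obtain ⟨f, hf, hmin⟩ := (isCompact_Icc.of_isClosed_subset hclosed hsub).exists_isMinOn
    ⟨0, hne⟩ hcont.continuousOn
  exact ⟨f, hf, fun g hg => hmin hg⟩

/-- An optimal flow. By strict convexity of the objective, its values on source and sink edges do
not depend on the choice. -/
def optFlow {n : ℕ} (G : SimpleGraph (Fin n)) (D : ℕ) : EdgeValues n :=
  (exists_isOptFlow G D).choose

/-- The extension of the degree list with threshold `D`: the sorted list of the flows leaving the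
source in an optimal flow. -/
def extDegList {n : ℕ} (G : SimpleGraph (Fin n)) (D : ℕ) : Fin n → ℝ := sortDesc (optFlow G D).1

/-! ### From degree lists to degree histograms -/

/-- `[x]_k = max {0, min {1, x - (k - 1)}}`. For `x ≥ 0` one has `[x]_0 = 1`. -/
def ramp (k : ℕ) (x : ℝ) : ℝ := max 0 (min 1 (x - ((k : ℝ) - 1)))

/-- The cumulative histogram of a (fractional) degree list; the entry at `0` is the length. -/
def cumHist {n : ℕ} (a : Fin n → ℝ) (k : ℕ) : ℝ := ∑ v, ramp k (a v)

/-- The histogram, with entries indexed by the degrees `0, …, D`, of a (fractional) degree list with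
entries in `[0, D]`. -/
def hist {n : ℕ} (D : ℕ) (a : Fin n → ℝ) (k : ℕ) : ℝ :=
  if k < D then cumHist a k - cumHist a (k + 1) else if k = D then cumHist a D else 0

/-! ### The generalized exponential mechanism -/

/-- The exponential mechanism for minimizing scores of sensitivity at most one: the index `i` is
drawn with probability proportional to `exp (-(ε / 2) * s i)`. -/
def expMech {ι : Type*} [Fintype ι] [Nonempty ι] (s : ι → ℝ) (ε : ℝ) : PMF ι :=
  PMF.normalize (fun i => ENNReal.ofReal (Real.exp (-(ε / 2) * s i)))
    (by
      obtain ⟨i⟩ := ‹Nonempty ι›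
      intro h
      have := ENNReal.tsum_eq_zero.1 h i
      rw [ENNReal.ofReal_eq_zero] at this
      exact absurd this (not_le.2 (Real.exp_pos _)))
    (by
      rw [tsum_fintype]
      exact ENNReal.sum_ne_top.2 fun i _ => ENNReal.ofReal_ne_top)

/-- The normalized score of the index `i`, for scores `q`, sensitivity bounds `Δ`, parameter `t`. -/
def normScore {ι : Type*} [Fintype ι] [Nonempty ι] (q Δ : ι → ℝ) (t : ℝ) (i : ι) : ℝ :=
  Finset.univ.sup' Finset.univ_nonempty
    fun j => ((q i + t * Δ i) - (q j + t * Δ j)) / (Δ i + Δ j)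

/-- The generalized exponential mechanism with scores `q`, sensitivity bounds `Δ` and parameters
`β` and `ε`: the exponential mechanism on the normalized scores with `t = 2 ln (k / β) / ε`,
where `k` is the number of indices. -/
def genExpMech {ι : Type*} [Fintype ι] [Nonempty ι] (q Δ : ι → ℝ) (β ε : ℝ) : PMF ι :=
  expMech (normScore q Δ (2 * Real.log ((Fintype.card ι : ℝ) / β) / ε)) ε

/-! ### Laplace noise -/

/-- The centered Laplace distribution with density `(1 / (2 c)) exp (-|z| / c)`. -/
def laplace (c : ℝ) : Measure ℝ :=
  volume.withDensity fun z => ENNReal.ofReal (1 / (2 * c) * Real.exp (-|z| / c))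

theorem isProbabilityMeasure_laplace {c : ℝ} (hc : 0 < c) : IsProbabilityMeasure (laplace c) := by
  have hint : ∫ z : ℝ, 1 / (2 * c) * Real.exp (-|z| / c) = 1 := by
    rw [integral_comp_abs (f := fun x => 1 / (2 * c) * Real.exp (-x / c)), integral_const_mul]
    have h : (fun x : ℝ => Real.exp (-x / c)) = fun x => Real.exp (-(1 / c) * x) := by
      funext x
      congr 1
      ring
    rw [h, integral_exp_mul_Ioi (by simpa using hc)]
    simp
    field_simp
  have hI : Integrable fun z : ℝ => 1 / (2 * c) * Real.exp (-|z| / c) := by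
    by_contra h
    rw [integral_undef h] at hint
    exact zero_ne_one hint
  constructor
  rw [laplace, withDensity_apply _ MeasurableSet.univ, Measure.restrict_univ,
    ← ofReal_integral_eq_lintegral_ofReal hI (ae_of_all _ fun z => by positivity), hint,
    ENNReal.ofReal_one]

/-! ### The algorithm -/

/-- The number `⌊log₂ n⌋ + 1` of candidate thresholds `1, 2, 4, …, 2 ^ ⌊log₂ n⌋`; the candidate
with index `i` is `2 ^ i`. -/
abbrev numThr (n : ℕ) : ℕ := Nat.log 2 n + 1

/-- The score of the threshold `D`. -/
def err {n : ℕ} (G : SimpleGraph (Fin n)) (ε : ℝ) (D : ℕ) : ℝ :=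
  (∑ v, |extDegList G D v - degList G v|) + 6 * (D : ℝ) ^ 2 / ε

/-- The random choice of (the index of) the threshold: the generalized exponential mechanism with
score `err D` and sensitivity bound `D` for the threshold `D`. -/
def selectThr {n : ℕ} (G : SimpleGraph (Fin n)) (β ε : ℝ) : PMF (Fin (numThr n)) :=
  genExpMech (fun i => err G ε (2 ^ (i : ℕ))) (fun i => (2 : ℝ) ^ (i : ℕ)) β ε

/-- The noisy histogram with threshold `D` when the noise is `Y`; it vanishes beyond `D`. -/
def noisyHist {n : ℕ} (G : SimpleGraph (Fin n)) (D : ℕ) (Y : Fin (D + 1) → ℝ) (k : ℕ) : ℝ :=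
  if hk : k < D + 1 then hist D (extDegList G D) k + Y ⟨k, hk⟩ else 0

/-- The noisy histogram, divided by its `ℓ₁` norm. -/
def estimate {n : ℕ} (G : SimpleGraph (Fin n)) (D : ℕ) (Y : Fin (D + 1) → ℝ) (k : ℕ) : ℝ :=
  noisyHist G D Y k / ∑ j ∈ Finset.range (D + 1), |noisyHist G D Y j|

/-- The law of the estimate for the fixed threshold `D`, when the noise has independent entries
with the Laplace distribution of parameter `b * D / ε`. -/
def estimateLaw {n : ℕ} (G : SimpleGraph (Fin n)) (b ε : ℝ) (D : ℕ) : Measure (ℕ → ℝ) :=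
  (Measure.pi fun _ : Fin (D + 1) => laplace (b * D / ε)).map (estimate G D)

/-- The law of the output of the algorithm: select a threshold, then release the estimate for it. -/
def comboLaw {n : ℕ} (G : SimpleGraph (Fin n)) (b β ε : ℝ) : Measure (ℕ → ℝ) :=
  (selectThr G β ε).toMeasure.bind fun i => estimateLaw G b ε (2 ^ (i : ℕ))

theorem measurable_estimate {n : ℕ} (G : SimpleGraph (Fin n)) (D : ℕ) :
    Measurable (estimate G D) := by
  have h : ∀ k, Measurable fun Y => noisyHist G D Y k := by
    intro k
    unfold noisyHist
    split_ifs <;> fun_prop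
  refine measurable_pi_lambda _ fun k => ?_
  exact (h k).div (Finset.measurable_fun_sum _ fun j _ => (h j).abs)

theorem isProbabilityMeasure_estimateLaw {n : ℕ} (G : SimpleGraph (Fin n)) {b ε : ℝ} (hb : 0 < b)
    (hε : 0 < ε) {D : ℕ} (hD : 0 < D) : IsProbabilityMeasure (estimateLaw G b ε D) := by
  have hD' : (0 : ℝ) < D := by exact_mod_cast hD
  have := isProbabilityMeasure_laplace (c := b * D / ε) (by positivity)
  exact Measure.isProbabilityMeasure_map (measurable_estimate G D).aemeasurable

theorem isProbabilityMeasure_comboLaw {n : ℕ} (G : SimpleGraph (Fin n)) {b ε : ℝ} (β : ℝ)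
    (hb : 0 < b) (hε : 0 < ε) : IsProbabilityMeasure (comboLaw G b β ε) :=
  isProbabilityMeasure_bind Measurable.of_discrete.aemeasurable
    (ae_of_all _ fun i => isProbabilityMeasure_estimateLaw G hb hε (by positivity))

/-- The `ℓ₁` distance between two sequences. -/
def l1Dist (p q : ℕ → ℝ) : ℝ≥0∞ := ∑' k, ‖p k - q k‖ₑ

/-- The expected `ℓ₁` error of the output as an estimate of the degree distribution. -/
def expectedError {n : ℕ} (G : SimpleGraph (Fin n)) (b β ε : ℝ) : ℝ≥0∞ :=
  ∫⁻ p, l1Dist p (degDist G) ∂(comboLaw G b β ε)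

end

end NodeDP

namespace NodeDP

/-! ### Sorted lists -/

/-! For a fixed threshold `D` the expected error is at most a constant times `err G ε D / n`:
passing to histograms costs a factor two, normalizing another two, and the total noise is of order
`D ^ 2 / ε` (`lintegral_estimateLaw_le`). The generalized exponential mechanism chooses a threshold
whose expected score is, up to constants, at most `err G ε D + D * log (numThr n) / ε` for every
candidate `D` (`expectedError_le`). It remains to exhibit one good candidate.

An optimal flow is a maximum flow, so a cut argument bounds the truncation error by twice the total
excess of the degrees over `D` (`IsOptFlow.sum_deg_sub_le`). Under `α`-decay this is `O(n * Av ^ α *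
D ^ (1 - α))`. Equating it with `D ^ 2 / ε` gives the threshold `x = (ε * n * Av ^ α) ^ (1 / (α +
1))`, and the error `x ^ 2 / (ε * n)` is the rate in the theorem; selection adds `x * ln ln n / (ε *
n)`. If `x` is not usable as a threshold, the rate is bounded below and the trivial error bound 2
suffices (`exists_expectedError_le`).

For (1), `x ≥ 1` bounds the selection term by the rate times `ln ln n`. For (2), it is the geometric
mean of `x ^ 2 / (ε * n)`, which tends to zero, and `(ln ln n) ^ 2 / (ε * n)`, which is bounded. -/

theorem sum_sortDesc {n : ℕ} {M : Type*} [AddCommMonoid M] (a : Fin n → ℝ) (g : ℝ → M) :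
    ∑ i, g (sortDesc a i) = ∑ i, g (a i) :=
  Equiv.sum_comp (Tuple.sort fun j => -a j) fun i => g (a i)

theorem antitone_sortDesc {n : ℕ} (a : Fin n → ℝ) : Antitone (sortDesc a) := by
  intro i j hij
  have := Tuple.monotone_sort (fun j => -a j) hij
  simpa [sortDesc] using this

/-- Sorting does not change how many entries exceed a level `y`. With `y` the `i`-th largest entry
of `d`, at most `i` entries of `d` exceed it, whereas a violation would make at least `i + 1`
entries of `a` do so. -/
theorem sortDesc_mono {n : ℕ} {a d : Fin n → ℝ} (h : ∀ v, a v ≤ d v) (i : Fin n) :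
    sortDesc a i ≤ sortDesc d i := by
  by_contra! hlt
  set y := sortDesc d i with hy
  have key : ∀ c : Fin n → ℝ, (Finset.univ.filter fun j => y < sortDesc c j).card =
      (Finset.univ.filter fun j => y < c j).card := by
    intro c
    simp only [Finset.card_filter]
    exact sum_sortDesc c fun x => if y < x then 1 else 0
  have h1 : (i : ℕ) + 1 ≤ (Finset.univ.filter fun j => y < sortDesc a j).card := by
    rw [← Fin.card_Iic]
    refine Finset.card_le_card fun j hj => ?_
    simp only [Finset.mem_Iic] at hj
    simp only [Finset.mem_filter, Finset.mem_univ, true_and]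
    exact hlt.trans_le (antitone_sortDesc a hj)
  have h2 : (Finset.univ.filter fun j => y < sortDesc d j).card ≤ i := by
    rw [← Fin.card_Iio]
    refine Finset.card_le_card fun j hj => ?_
    simp only [Finset.mem_filter, Finset.mem_univ, true_and] at hj
    rw [Finset.mem_Iio]
    by_contra! hji
    exact absurd hj (not_lt.2 (antitone_sortDesc d hji))
  have h3 : (Finset.univ.filter fun j => y < a j).card ≤
      (Finset.univ.filter fun j => y < d j).card :=
    Finset.card_le_card <| Finset.monotone_filter_right _ fun j _ hj => lt_of_lt_of_le hj (h j)
  rw [key] at h1 h2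
  omega

theorem sum_abs_sortDesc_sub {n : ℕ} {a d : Fin n → ℝ} (h : ∀ v, a v ≤ d v) :
    ∑ i, |sortDesc a i - sortDesc d i| = ∑ v, (d v - a v) := by
  have : ∀ i, |sortDesc a i - sortDesc d i| = sortDesc d i - sortDesc a i := fun i => by
    rw [abs_sub_comm, abs_of_nonneg (sub_nonneg.2 (sortDesc_mono h i))]
  simp only [this, Finset.sum_sub_distrib]
  rw [sum_sortDesc d fun x => x, sum_sortDesc a fun x => x]

/-! ### Optimal flows are maximum flows -/

open scoped Classical in
/-- The capacity of the edge from `u_ℓ` to `v_r`. -/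
noncomputable def midCap {n : ℕ} (G : SimpleGraph (Fin n)) (u v : Fin n) : ℝ :=
  if G.Adj u v then 1 else 0

theorem midCap_comm {n : ℕ} (G : SimpleGraph (Fin n)) (u v : Fin n) :
    midCap G u v = midCap G v u := by
  unfold midCap
  congr 1
  exact propext (G.adj_comm u v)

theorem sum_midCap {n : ℕ} (G : SimpleGraph (Fin n)) (u : Fin n) :
    ∑ v, midCap G u v = deg G u := by
  classical
  simp only [midCap, Finset.sum_boole, deg]
  rw [← SimpleGraph.card_neighborFinset_eq_degree, SimpleGraph.neighborFinset_eq_filter]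

theorem sum_midCap_left {n : ℕ} (G : SimpleGraph (Fin n)) (v : Fin n) :
    ∑ u, midCap G u v = deg G v := by
  simp only [fun u => midCap_comm G u v, sum_midCap]

/-- The directions in which the values on the middle edges can be changed. -/
def IsResidual {n : ℕ} (G : SimpleGraph (Fin n)) (m h : Fin n → Fin n → ℝ) : Prop :=
  ∀ u v, (m u v = 0 → 0 ≤ h u v) ∧ (m u v = midCap G u v → h u v ≤ 0)

/-- The sign conditions cut out a cone. Adding directions therefore replaces concatenation of
residual paths, and no walks are needed. -/
theorem IsResidual.add {n : ℕ} {G : SimpleGraph (Fin n)} {m h h' : Fin n → Fin n → ℝ}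
    (H : IsResidual G m h) (H' : IsResidual G m h') : IsResidual G m (h + h') := fun u v =>
  ⟨fun e => add_nonneg ((H u v).1 e) ((H' u v).1 e),
    fun e => add_nonpos ((H u v).2 e) ((H' u v).2 e)⟩

/-- The direction which increases the value on a single middle edge. -/
def edgeDir {n : ℕ} (u v : Fin n) : Fin n → Fin n → ℝ := Pi.single u (Pi.single v 1)

theorem edgeDir_apply {n : ℕ} (u v u' v' : Fin n) :
    edgeDir u v u' v' = if u' = u ∧ v' = v then 1 else 0 := by
  by_cases h1 : u' = u
  · subst h1
    by_cases h2 : v' = v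
    · subst h2; simp [edgeDir]
    · simp [edgeDir, h2]
  · simp [edgeDir, h1]

theorem sum_edgeDir_row {n : ℕ} (u v w : Fin n) :
    ∑ x, edgeDir u v w x = (Pi.single u 1 : Fin n → ℝ) w := by
  by_cases h : w = u <;> simp [edgeDir_apply, h]

theorem sum_edgeDir_col {n : ℕ} (u v x : Fin n) :
    ∑ w, edgeDir u v w x = (Pi.single v 1 : Fin n → ℝ) x := by
  by_cases h : x = v <;> simp [edgeDir_apply, h]

theorem isResidual_edgeDir {n : ℕ} {G : SimpleGraph (Fin n)} {m : Fin n → Fin n → ℝ} {u v : Fin n}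
    (h : m u v ≠ midCap G u v) : IsResidual G m (edgeDir u v) := by
  intro u' v'
  rw [edgeDir_apply]
  split_ifs with hc
  · obtain ⟨rfl, rfl⟩ := hc
    exact ⟨fun _ => zero_le_one, fun e => absurd e h⟩
  · exact ⟨fun _ => le_rfl, fun _ => le_rfl⟩

theorem isResidual_neg_edgeDir {n : ℕ} {G : SimpleGraph (Fin n)} {m : Fin n → Fin n → ℝ}
    {u v : Fin n} (h : m u v ≠ 0) : IsResidual G m (-edgeDir u v) := by
  intro u' v'
  rw [Pi.neg_apply, Pi.neg_apply, edgeDir_apply]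
  split_ifs with hc
  · obtain ⟨rfl, rfl⟩ := hc
    exact ⟨fun e => absurd e h, fun _ => by norm_num⟩
  · exact ⟨fun _ => by norm_num, fun _ => by norm_num⟩

/-- A tight constraint is preserved by the sign condition, a slack one by continuity. -/
theorem IsResidual.eventually {n : ℕ} {G : SimpleGraph (Fin n)} {m h : Fin n → Fin n → ℝ}
    (H : IsResidual G m h) (h0 : ∀ u v, 0 ≤ m u v) (h1 : ∀ u v, m u v ≤ midCap G u v) :
    ∀ᶠ t in 𝓝[>] (0 : ℝ), ∀ u v, 0 ≤ m u v + t * h u v ∧ m u v + t * h u v ≤ midCap G u v := by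
  refine eventually_all.2 fun u => eventually_all.2 fun v => ?_
  have hlim : Tendsto (fun t : ℝ => m u v + t * h u v) (𝓝[>] 0) (𝓝 (m u v)) := by
    have : Continuous fun t : ℝ => m u v + t * h u v := by fun_prop
    simpa using (this.tendsto 0).mono_left nhdsWithin_le_nhds
  refine Eventually.and ?_ ?_
  · rcases (h0 u v).eq_or_lt with e | e
    · filter_upwards [self_mem_nhdsWithin] with t ht
      rw [← e, zero_add]
      exact mul_nonneg (le_of_lt ht) ((H u v).1 e.symm)
    · exact (hlim.eventually_const_lt e).mono fun _ => le_of_lt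
  · rcases (h1 u v).eq_or_lt with e | e
    · filter_upwards [self_mem_nhdsWithin] with t ht
      have := mul_nonpos_of_nonneg_of_nonpos (le_of_lt ht : (0 : ℝ) ≤ t) ((H u v).2 e)
      linarith
    · exact (hlim.eventually_lt_const e).mono fun _ => le_of_lt

/-- An optimal flow admits no augmentation from an unsaturated source edge to an unsaturated
sink edge. -/
theorem IsOptFlow.no_augment {n : ℕ} {G : SimpleGraph (Fin n)} {D : ℕ} {f : EdgeValues n}
    (hf : IsOptFlow G D f) {h : Fin n → Fin n → ℝ} (H : IsResidual G f.2.1 h) {u₀ v : Fin n}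
    (hrow : ∀ w, ∑ x, h w x = (Pi.single u₀ 1 : Fin n → ℝ) w)
    (hcol : ∀ x, ∑ w, h w x = (Pi.single v 1 : Fin n → ℝ) x) (hu : f.1 u₀ < D) :
    f.2.2 v = D := by
  by_contra hne
  have hv : f.2.2 v < D := lt_of_le_of_ne (hf.1.snk_le v) hne
  have hsmall : ∀ c : ℝ, 0 < c → ∀ᶠ t in 𝓝[>] (0 : ℝ), t < c := fun c hc =>
    (eventually_lt_nhds hc).filter_mono nhdsWithin_le_nhds
  obtain ⟨t, hmid, ht1, ht2, ht0⟩ := ((H.eventually hf.1.mid_nonneg hf.1.mid_le).and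
    ((hsmall _ (sub_pos.2 hu)).and ((hsmall _ (sub_pos.2 hv)).and self_mem_nhdsWithin))).exists
  have ht0 : 0 < t := ht0
  set g : EdgeValues n := (fun w => f.1 w + t * (Pi.single u₀ 1 : Fin n → ℝ) w,
    fun w x => f.2.1 w x + t * h w x, fun x => f.2.2 x + t * (Pi.single v 1 : Fin n → ℝ) x) with hg
  have hsrc : ∀ w, f.1 w ≤ g.1 w ∧ g.1 w ≤ D := by
    intro w
    by_cases e : w = u₀
    · subst e; simp only [hg, Pi.single_eq_same]; constructor <;> linarith
    · simp only [hg, Pi.single_eq_of_ne e]; have := hf.1.src_le w; constructor <;> linarith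
  have hsnk : ∀ w, f.2.2 w ≤ g.2.2 w ∧ g.2.2 w ≤ D := by
    intro w
    by_cases e : w = v
    · subst e; simp only [hg, Pi.single_eq_same]; constructor <;> linarith
    · simp only [hg, Pi.single_eq_of_ne e]; have := hf.1.snk_le w; constructor <;> linarith
  have hgf : IsFlow G D g :=
    { src_nonneg := fun w => (hf.1.src_nonneg w).trans (hsrc w).1
      src_le := fun w => (hsrc w).2
      mid_nonneg := fun w x => (hmid w x).1
      mid_le := fun w x => (hmid w x).2
      snk_nonneg := fun w => (hf.1.snk_nonneg w).trans (hsnk w).1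
      snk_le := fun w => (hsnk w).2
      conserve_left := fun w => by
        simp only [hg, Finset.sum_add_distrib, ← Finset.mul_sum, hrow, hf.1.conserve_left]
      conserve_right := fun w => by
        simp only [hg, Finset.sum_add_distrib, ← Finset.mul_sum, hcol, hf.1.conserve_right] }
  refine absurd (hf.2 g hgf) (not_le.2 ?_)
  -- No source or sink value has decreased or passed `D`, so every summand weakly drops; the one at
  -- `u₀` drops strictly.
  refine Finset.sum_lt_sum (fun w _ => ?_) ⟨u₀, Finset.mem_univ _, ?_⟩
  · have := hsrc w; have := hsnk w
    gcongr <;> linarith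
  · have h1 := hsrc u₀; have h2 := hsnk u₀
    refine add_lt_add_of_lt_of_le ?_ ?_
    · have : f.1 u₀ < g.1 u₀ := by simp only [hg, Pi.single_eq_same]; linarith
      gcongr <;> linarith
    · gcongr <;> linarith

/-- Optimal flows have total value at least `2|E|` minus twice the total excess of the degrees over
the threshold. -/
theorem IsOptFlow.sum_deg_sub_le {n : ℕ} {G : SimpleGraph (Fin n)} {D : ℕ} {f : EdgeValues n}
    (hf : IsOptFlow G D f) :
    ∑ v, ((deg G v : ℝ) - f.1 v) ≤ 2 * ∑ v, max ((deg G v : ℝ) - D) 0 := by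
  classical
  set m := f.2.1 with hm
  -- `S` and `T` are the left and right copies reachable in the residual graph from an unsaturated
  -- source edge. Row and column sums of the direction record the endpoints of the path.
  let S : Finset (Fin n) := Finset.univ.filter fun u => ∃ u₀ h, f.1 u₀ < D ∧ IsResidual G m h ∧
    (∀ w, ∑ x, h w x = (Pi.single u₀ 1 : Fin n → ℝ) w - (Pi.single u 1 : Fin n → ℝ) w) ∧
    ∀ x, ∑ w, h w x = 0
  let T : Finset (Fin n) := Finset.univ.filter fun v => ∃ u₀ h, f.1 u₀ < D ∧ IsResidual G m h ∧
    (∀ w, ∑ x, h w x = (Pi.single u₀ 1 : Fin n → ℝ) w) ∧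
    ∀ x, ∑ w, h w x = (Pi.single v 1 : Fin n → ℝ) x
  have hS : ∀ u, u ∉ S → f.1 u = D := by
    intro u hu
    by_contra hne
    refine hu (Finset.mem_filter.2 ⟨Finset.mem_univ _, u, 0,
      lt_of_le_of_ne (hf.1.src_le u) hne, fun _ _ => ⟨fun _ => le_rfl, fun _ => le_rfl⟩, ?_, ?_⟩)
      <;> simp
  have hT : ∀ v, v ∈ T → f.2.2 v = D := by
    intro v hv
    obtain ⟨u₀, h, hu, H, hr, hc⟩ := (Finset.mem_filter.1 hv).2
    exact hf.no_augment H hr hc hu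
  have hST : ∀ u ∈ S, ∀ v, v ∉ T → m u v = midCap G u v := by
    intro u hu v hv
    by_contra hne
    obtain ⟨u₀, h, hu0, H, hr, hc⟩ := (Finset.mem_filter.1 hu).2
    refine hv (Finset.mem_filter.2 ⟨Finset.mem_univ _, u₀, h + edgeDir u v, hu0,
      H.add (isResidual_edgeDir hne), fun w => ?_, fun x => ?_⟩)
    · simp [Finset.sum_add_distrib, hr, sum_edgeDir_row]
    · simp [Finset.sum_add_distrib, hc, sum_edgeDir_col]
  have hTS : ∀ u, u ∉ S → ∀ v ∈ T, m u v = 0 := by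
    intro u hu v hv
    by_contra hne
    obtain ⟨u₀, h, hu0, H, hr, hc⟩ := (Finset.mem_filter.1 hv).2
    refine hu (Finset.mem_filter.2 ⟨Finset.mem_univ _, u₀, h + -edgeDir u v, hu0,
      H.add (isResidual_neg_edgeDir hne), fun w => ?_, fun x => ?_⟩)
    · simp only [Pi.add_apply, Pi.neg_apply, Finset.sum_add_distrib, hr, Finset.sum_neg_distrib,
        sum_edgeDir_row, sub_eq_add_neg]
    · simp only [Pi.add_apply, Pi.neg_apply, Finset.sum_add_distrib, hc, Finset.sum_neg_distrib,
        sum_edgeDir_col, add_neg_cancel]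
  have hpos : ∀ u v, 0 ≤ midCap G u v - m u v := fun u v => sub_nonneg.2 (hf.1.mid_le u v)
  -- Unused capacity occurs only on pairs with `u ∉ S` or `v ∈ T`; pairs with both are counted
  -- twice, harmlessly.
  have hle : ∀ u v, midCap G u v - m u v ≤
      (if u ∈ S then 0 else midCap G u v - m u v) + if v ∈ T then midCap G u v - m u v else 0 := by
    intro u v
    have := hpos u v
    by_cases h1 : u ∈ S <;> by_cases h2 : v ∈ T <;> simp [h1, h2, this]
    rw [hST u h1 v h2]
  have hrow : ∀ u, ∑ v, (midCap G u v - m u v) = deg G u - f.1 u := fun u => by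
    rw [Finset.sum_sub_distrib, sum_midCap, hf.1.conserve_left]
  have hcol : ∀ v, ∑ u, (midCap G u v - m u v) = deg G v - f.2.2 v := fun v => by
    rw [Finset.sum_sub_distrib, sum_midCap_left, hf.1.conserve_right]
  calc ∑ v, ((deg G v : ℝ) - f.1 v) = ∑ u, ∑ v, (midCap G u v - m u v) := by simp only [hrow]
    _ ≤ ∑ u, ∑ v, ((if u ∈ S then 0 else midCap G u v - m u v) +
          if v ∈ T then midCap G u v - m u v else 0) :=
        Finset.sum_le_sum fun u _ => Finset.sum_le_sum fun v _ => hle u v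
    _ = (∑ u, if u ∈ S then 0 else (deg G u - f.1 u)) +
          ∑ v, if v ∈ T then (deg G v - f.2.2 v) else 0 := by
        simp only [Finset.sum_add_distrib]
        congr 1
        · refine Finset.sum_congr rfl fun u _ => ?_
          split_ifs <;> simp [← hrow]
        · rw [Finset.sum_comm]
          refine Finset.sum_congr rfl fun v _ => ?_
          split_ifs <;> simp [← hcol]
    -- Source edges outside `S` and sink edges in `T` are saturated, so each side contributes at
    -- most the total excess; this is the factor two.
    _ ≤ (∑ v, max ((deg G v : ℝ) - D) 0) + ∑ v, max ((deg G v : ℝ) - D) 0 := by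
        refine add_le_add (Finset.sum_le_sum fun u _ => ?_) (Finset.sum_le_sum fun v _ => ?_)
        · split_ifs with h
          · exact le_max_right _ _
          · rw [hS u h]; exact le_max_left _ _
        · split_ifs with h
          · rw [hT v h]; exact le_max_left _ _
          · exact le_max_right _ _
    _ = _ := by ring

theorem IsFlow.src_le_deg {n : ℕ} {G : SimpleGraph (Fin n)} {D : ℕ} {f : EdgeValues n}
    (hf : IsFlow G D f) (v : Fin n) : f.1 v ≤ deg G v := by
  rw [hf.conserve_left, ← sum_midCap]
  exact Finset.sum_le_sum fun w _ => hf.mid_le v w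

theorem isOptFlow_optFlow {n : ℕ} (G : SimpleGraph (Fin n)) (D : ℕ) :
    IsOptFlow G D (optFlow G D) := (exists_isOptFlow G D).choose_spec

theorem sum_abs_extDegList_sub_le {n : ℕ} (G : SimpleGraph (Fin n)) (D : ℕ) :
    ∑ v, |extDegList G D v - degList G v| ≤ 2 * ∑ v, max ((deg G v : ℝ) - D) 0 := by
  have h := isOptFlow_optFlow G D
  rw [extDegList, degList, sum_abs_sortDesc_sub h.1.src_le_deg]
  exact h.sum_deg_sub_le

theorem extDegList_nonneg {n : ℕ} (G : SimpleGraph (Fin n)) (D : ℕ) (v : Fin n) :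
    0 ≤ extDegList G D v := (isOptFlow_optFlow G D).1.src_nonneg _

theorem extDegList_le {n : ℕ} (G : SimpleGraph (Fin n)) (D : ℕ) (v : Fin n) :
    extDegList G D v ≤ D := (isOptFlow_optFlow G D).1.src_le _

/-! ### Histograms -/

theorem ramp_mono (k : ℕ) : Monotone (ramp k) := fun x y h => by
  unfold ramp; gcongr

theorem ramp_zero_of_nonneg {x : ℝ} (hx : 0 ≤ x) : ramp 0 x = 1 := by
  unfold ramp
  rw [min_eq_left (by push_cast; linarith), max_eq_right zero_le_one]

theorem ramp_eq_zero {k : ℕ} {x : ℝ} (hx : x ≤ (k : ℝ) - 1) : ramp k x = 0 := by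
  unfold ramp
  exact max_eq_left ((min_le_right _ _).trans (by linarith))

theorem ramp_natCast (k d : ℕ) : ramp k d = if k ≤ d then 1 else 0 := by
  unfold ramp
  split_ifs with h
  · have : (k : ℝ) ≤ d := by exact_mod_cast h
    rw [min_eq_left (by linarith), max_eq_right zero_le_one]
  · have : (d : ℝ) + 1 ≤ k := by exact_mod_cast (by omega : d + 1 ≤ k)
    exact max_eq_left ((min_le_right _ _).trans (by linarith))

/-- The ramps cut `[0, N]` into unit slices and measure the part of each slice below `x`. -/
theorem sum_ramp (N : ℕ) {x : ℝ} (hx : 0 ≤ x) :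
    ∑ k ∈ Finset.range N, ramp (k + 1) x = min x N := by
  induction N with
  | zero => simp [hx]
  | succ N ih =>
    rw [Finset.sum_range_succ, ih]
    unfold ramp
    push_cast
    rcases le_total x N with h | h
    · rw [min_eq_left h, min_eq_left (by linarith : x ≤ N + 1),
        max_eq_left ((min_le_right _ _).trans (by linarith)), add_zero]
    · rw [min_eq_right h]
      rcases le_total x (N + 1) with h' | h'
      · rw [min_eq_left h', min_eq_right (by linarith), max_eq_right (by linarith)]; ring
      · rw [min_eq_right h', min_eq_left (by linarith), max_eq_right (by linarith)]

/-- By monotonicity all differences have the same sign, so the sum is a difference of two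
truncations at `N`. -/
theorem sum_abs_ramp_sub_le (N : ℕ) {x y : ℝ} (hx : 0 ≤ x) (hy : 0 ≤ y) :
    ∑ k ∈ Finset.range N, |ramp (k + 1) x - ramp (k + 1) y| ≤ |x - y| := by
  wlog h : y ≤ x generalizing x y
  · have := this hy hx (le_of_not_ge h)
    simpa only [abs_sub_comm] using this
  have : ∀ k, |ramp (k + 1) x - ramp (k + 1) y| = ramp (k + 1) x - ramp (k + 1) y := fun k =>
    abs_of_nonneg (sub_nonneg.2 (ramp_mono _ h))
  simp only [this, Finset.sum_sub_distrib, sum_ramp N hx, sum_ramp N hy]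
  rw [abs_of_nonneg (sub_nonneg.2 h)]
  rcases le_total x N with h1 | h1 <;> rcases le_total y N with h2 | h2 <;> simp [h1, h2] <;>
    linarith

theorem hist_eq {n : ℕ} {D : ℕ} {a : Fin n → ℝ} (ha : ∀ v, a v ≤ D) (k : ℕ) :
    hist D a k = cumHist a k - cumHist a (k + 1) := by
  have hz : ∀ j, D < j → cumHist a j = 0 := fun j hj => by
    refine Finset.sum_eq_zero fun v _ => ramp_eq_zero ((ha v).trans ?_)
    have : (D : ℝ) + 1 ≤ j := by exact_mod_cast hj
    linarith
  unfold hist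
  split_ifs with h1 h2
  · rfl
  · subst h2; rw [hz _ (Nat.lt_succ_self _), sub_zero]
  · rw [hz k (by omega), hz (k + 1) (by omega), sub_zero]

theorem cumHist_zero {n : ℕ} {a : Fin n → ℝ} (ha : ∀ v, 0 ≤ a v) : cumHist a 0 = n := by
  simp [cumHist, ramp_zero_of_nonneg, ha]

theorem degList_nonneg {n : ℕ} (G : SimpleGraph (Fin n)) (v : Fin n) : 0 ≤ degList G v :=
  Nat.cast_nonneg (deg G _)

theorem cumHist_degList_sub {n : ℕ} (G : SimpleGraph (Fin n)) (k : ℕ) :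
    cumHist (degList G) k - cumHist (degList G) (k + 1) = n * degDist G k := by
  rcases n.eq_zero_or_pos with rfl | hn
  · simp [cumHist]
  have hn' : (n : ℝ) ≠ 0 := by positivity
  rw [degDist, mul_div_cancel₀ _ hn']
  simp only [cumHist, degList, sum_sortDesc (fun v => (deg G v : ℝ)) (ramp _)]
  rw [← Finset.sum_sub_distrib, Finset.card_filter, Nat.cast_sum]
  refine Finset.sum_congr rfl fun v _ => ?_
  rw [ramp_natCast, ramp_natCast]
  rcases lt_trichotomy (deg G v) k with h | h | h
  · simp [h.not_ge, h.ne, show ¬ k + 1 ≤ deg G v by omega]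
  · simp [h]
  · simp [h.le, h.ne', show k + 1 ≤ deg G v by omega]

theorem sum_abs_cumHist_sub_le {n : ℕ} (N : ℕ) {a d : Fin n → ℝ} (ha : ∀ v, 0 ≤ a v)
    (hd : ∀ v, 0 ≤ d v) :
    ∑ k ∈ Finset.range N, |cumHist a (k + 1) - cumHist d (k + 1)| ≤ ∑ v, |a v - d v| := by
  calc _ ≤ ∑ k ∈ Finset.range N, ∑ v, |ramp (k + 1) (a v) - ramp (k + 1) (d v)| := by
        refine Finset.sum_le_sum fun k _ => ?_
        rw [cumHist, cumHist, ← Finset.sum_sub_distrib]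
        exact Finset.abs_sum_le_sum_abs _ _
    _ = ∑ v, ∑ k ∈ Finset.range N, |ramp (k + 1) (a v) - ramp (k + 1) (d v)| := Finset.sum_comm
    _ ≤ _ := Finset.sum_le_sum fun v _ => sum_abs_ramp_sub_le N (ha v) (hd v)

/-- Each histogram entry is a difference of two consecutive cumulative entries, whence the factor
two. -/
theorem sum_abs_hist_sub_le {n : ℕ} (G : SimpleGraph (Fin n)) (D N : ℕ) :
    ∑ k ∈ Finset.range N, |hist D (extDegList G D) k - n * degDist G k| ≤
      2 * ∑ v, |extDegList G D v - degList G v| := by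
  set a := extDegList G D
  set d := degList G
  have ha := extDegList_nonneg G D
  have hd := degList_nonneg G
  have key := fun N => sum_abs_cumHist_sub_le N ha hd
  have hkey : ∑ k ∈ Finset.range N, |cumHist a k - cumHist d k| ≤ ∑ v, |a v - d v| := by
    cases N with
    | zero => simpa using Finset.sum_nonneg fun v _ => abs_nonneg (a v - d v)
    | succ N =>
      -- Both cumulative histograms equal `n` at index zero, so this term costs nothing.
      rw [Finset.sum_range_succ', cumHist_zero ha, cumHist_zero hd, sub_self, abs_zero, add_zero]
      exact key N
  calc _ ≤ ∑ k ∈ Finset.range N, (|cumHist a k - cumHist d k| +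
          |cumHist a (k + 1) - cumHist d (k + 1)|) := by
        refine Finset.sum_le_sum fun k _ => ?_
        rw [hist_eq (extDegList_le G D), ← cumHist_degList_sub]
        refine le_trans (le_of_eq ?_) (abs_sub _ _)
        congr 1
        ring
    _ ≤ _ := by rw [Finset.sum_add_distrib, two_mul]; exact add_le_add hkey (key N)

/-! ### The error of the estimate -/

theorem deg_lt {n : ℕ} (G : SimpleGraph (Fin n)) (v : Fin n) : deg G v < n := by
  classical
  have := G.degree_lt_card_verts v
  simpa [deg] using this

theorem degDist_nonneg {n : ℕ} (G : SimpleGraph (Fin n)) (k : ℕ) : 0 ≤ degDist G k := by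
  unfold degDist; positivity

theorem degDist_eq_zero {n : ℕ} (G : SimpleGraph (Fin n)) {k : ℕ} (hk : n ≤ k) :
    degDist G k = 0 := by
  rw [degDist, Finset.card_eq_zero.2, Nat.cast_zero, zero_div]
  exact Finset.filter_eq_empty_iff.2 fun v _ => ((deg_lt G v).trans_le hk).ne

theorem sum_degDist {n : ℕ} (G : SimpleGraph (Fin n)) (hn : 0 < n) {N : ℕ} (hN : n ≤ N) :
    ∑ k ∈ Finset.range N, degDist G k = 1 := by
  have hn' : (n : ℝ) ≠ 0 := by positivity
  simp only [degDist, ← Finset.sum_div]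
  rw [div_eq_one_iff_eq hn', ← Nat.cast_sum, ← Finset.card_eq_sum_card_fiberwise]
  · simp
  · intro v _
    simpa using (deg_lt G v).trans_le hN

theorem noisyHist_eq_zero {n : ℕ} (G : SimpleGraph (Fin n)) {D : ℕ} (Y : Fin (D + 1) → ℝ) {k : ℕ}
    (hk : D < k) : noisyHist G D Y k = 0 := by
  rw [noisyHist, dif_neg (by omega)]

/-- The estimate vanishes beyond `D` and the degree distribution from `n` on, so the range covers
both supports. -/
theorem l1Dist_estimate {n : ℕ} (G : SimpleGraph (Fin n)) {D : ℕ} (Y : Fin (D + 1) → ℝ) :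
    l1Dist (estimate G D Y) (degDist G) =
      ENNReal.ofReal (∑ k ∈ Finset.range (D + 1 + n), |estimate G D Y k - degDist G k|) := by
  rw [l1Dist, tsum_eq_sum (s := Finset.range (D + 1 + n)), ENNReal.ofReal_sum_of_nonneg]
  · exact Finset.sum_congr rfl fun k _ => Real.enorm_eq_ofReal_abs _
  · exact fun _ _ => abs_nonneg _
  · intro k hk
    rw [Finset.mem_range, not_lt] at hk
    rw [estimate, noisyHist_eq_zero G Y (by omega), degDist_eq_zero G (by omega)]
    simp

theorem sum_abs_noisyHist {n : ℕ} (G : SimpleGraph (Fin n)) {D : ℕ} (Y : Fin (D + 1) → ℝ)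
    (m : ℕ) : ∑ k ∈ Finset.range (D + 1 + m), |noisyHist G D Y k| =
      ∑ k ∈ Finset.range (D + 1), |noisyHist G D Y k| := by
  rw [Finset.sum_range_add, add_eq_left]
  exact Finset.sum_eq_zero fun k _ => by rw [noisyHist_eq_zero G Y (by omega), abs_zero]

theorem sum_abs_noisyHist_sub_le {n : ℕ} (G : SimpleGraph (Fin n)) {D : ℕ} (Y : Fin (D + 1) → ℝ) :
    ∑ k ∈ Finset.range (D + 1 + n), |noisyHist G D Y k - n * degDist G k| ≤
      2 * (∑ v, |extDegList G D v - degList G v|) + ∑ i, |Y i| := by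
  have h1 := sum_abs_hist_sub_le G D (D + 1 + n)
  have h2 : ∀ k, |noisyHist G D Y k - n * degDist G k| ≤
      |hist D (extDegList G D) k - n * degDist G k| +
        if hk : k < D + 1 then |Y ⟨k, hk⟩| else 0 := by
    intro k
    unfold noisyHist
    split_ifs with hk
    · rw [add_sub_right_comm]; exact abs_add_le _ _
    · rw [hist_eq (extDegList_le G D)]
      have hz : ∀ j, D < j → cumHist (extDegList G D) j = 0 := fun j hj => by
        refine Finset.sum_eq_zero fun v _ => ramp_eq_zero ((extDegList_le G D v).trans ?_)
        have : (D : ℝ) + 1 ≤ j := by exact_mod_cast hj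
        linarith
      rw [hz k (by omega), hz (k + 1) (by omega)]
      simp
  have h3 : ∑ k ∈ Finset.range (D + 1 + n), (if hk : k < D + 1 then |Y ⟨k, hk⟩| else 0) =
      ∑ i, |Y i| := by
    rw [Finset.sum_range_add]
    have : ∑ x ∈ Finset.range n, (if hk : D + 1 + x < D + 1 then |Y ⟨D + 1 + x, hk⟩| else 0) = 0 :=
      Finset.sum_eq_zero fun x _ => dif_neg (by omega)
    rw [this, add_zero, Finset.sum_range]
    exact Finset.sum_congr rfl fun i _ => dif_pos i.isLt
  calc _ ≤ _ := Finset.sum_le_sum fun k _ => h2 k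
    _ = _ := by rw [Finset.sum_add_distrib, h3]
    _ ≤ _ := by linarith

/-- Dividing by the norm `S` instead of `n` costs `|S - n| / n`. As `n * degDist G` has norm `n`,
this is at most the error already present before normalization. -/
theorem l1Dist_estimate_le {n : ℕ} (G : SimpleGraph (Fin n)) (hn : 0 < n) {D : ℕ}
    (Y : Fin (D + 1) → ℝ) :
    l1Dist (estimate G D Y) (degDist G) ≤ ENNReal.ofReal
      ((4 * (∑ v, |extDegList G D v - degList G v|) + 2 * ∑ i, |Y i|) / n) := by
  have hn' : (0 : ℝ) < n := by positivity
  rw [l1Dist_estimate]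
  refine ENNReal.ofReal_le_ofReal ?_
  set h := noisyHist G D Y with hh
  set S := ∑ k ∈ Finset.range (D + 1), |h k| with hS
  set E := ∑ k ∈ Finset.range (D + 1 + n), |h k - n * degDist G k| with hE
  have hEle : E ≤ _ := sum_abs_noisyHist_sub_le G Y
  have hS' : ∑ k ∈ Finset.range (D + 1 + n), |h k| = S := sum_abs_noisyHist G Y n
  have hp : ∑ k ∈ Finset.range (D + 1 + n), |n * degDist G k| = n := by
    simp only [abs_of_nonneg (mul_nonneg hn'.le (degDist_nonneg G _))]
    rw [← Finset.mul_sum, sum_degDist G hn (by omega), mul_one]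
  have hSn : |S - n| ≤ E := by
    rw [← hS', ← hp, ← Finset.sum_sub_distrib]
    refine (Finset.abs_sum_le_sum_abs _ _).trans ?_
    exact Finset.sum_le_sum fun k _ => abs_abs_sub_abs_le_abs_sub _ _
  have hSnn : 0 ≤ S := Finset.sum_nonneg fun _ _ => abs_nonneg _
  have h1 : ∀ k, |estimate G D Y k - degDist G k| ≤
      |h k / S - h k / n| + |h k - n * degDist G k| / n := by
    intro k
    have : |h k - n * degDist G k| / n = |h k / n - degDist G k| := by
      rw [← abs_of_pos hn', ← abs_div, abs_of_pos hn']
      congr 1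
      field_simp
    rw [this, estimate]
    exact abs_sub_le _ _ _
  have h2 : ∑ k ∈ Finset.range (D + 1 + n), |h k / S - h k / n| ≤ |S - n| / n := by
    rcases hSnn.eq_or_lt with h0 | h0
    -- If `S = 0`, all entries vanish, and so do both quotients, division by zero being zero.
    · have hz : ∀ k ∈ Finset.range (D + 1 + n), h k = 0 := by
        intro k hk
        rw [← h0] at hS'
        exact abs_eq_zero.1 ((Finset.sum_eq_zero_iff_of_nonneg fun _ _ => abs_nonneg _).1 hS' k hk)
      rw [Finset.sum_eq_zero fun k hk => by simp [hz k hk]]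
      positivity
    · have : ∀ k, |h k / S - h k / n| = |h k| * (|S - n| / (S * n)) := fun k => by
        rw [abs_sub_comm S, ← abs_of_pos (mul_pos h0 hn'), ← abs_div, ← abs_mul]
        congr 1
        field_simp
      simp only [this]
      rw [← Finset.sum_mul, hS']
      apply le_of_eq
      field_simp
  calc _ ≤ _ := Finset.sum_le_sum fun k _ => h1 k
    _ ≤ |S - n| / n + E / n := by
        rw [Finset.sum_add_distrib, ← Finset.sum_div]; gcongr
    _ ≤ (2 * E) / n := by rw [← add_div]; gcongr; linarith
    _ ≤ _ := by gcongr; linarith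

theorem l1Dist_estimate_le_two {n : ℕ} (G : SimpleGraph (Fin n)) (hn : 0 < n) {D : ℕ}
    (Y : Fin (D + 1) → ℝ) : l1Dist (estimate G D Y) (degDist G) ≤ 2 := by
  rw [l1Dist_estimate, ← ENNReal.ofReal_ofNat]
  refine ENNReal.ofReal_le_ofReal ?_
  calc _ ≤ ∑ k ∈ Finset.range (D + 1 + n), (|estimate G D Y k| + degDist G k) := by
        refine Finset.sum_le_sum fun k _ => (abs_sub _ _).trans ?_
        rw [abs_of_nonneg (degDist_nonneg G k)]
    _ ≤ 1 + 1 := by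
        rw [Finset.sum_add_distrib, sum_degDist G hn (by omega)]
        gcongr
        simp only [estimate, abs_div]
        rw [← Finset.sum_div, sum_abs_noisyHist,
          abs_of_nonneg (Finset.sum_nonneg fun _ _ => abs_nonneg _)]
        exact div_self_le_one _
    _ = 2 := by norm_num

/-! ### Laplace noise -/

theorem lintegral_abs_laplace {c : ℝ} (hc : 0 < c) :
    ∫⁻ z, ENNReal.ofReal |z| ∂(laplace c) = ENNReal.ofReal c := by
  have hval : ∫ x in Set.Ioi (0 : ℝ), x * Real.exp (-(1 / c) * x) = c ^ 2 := by
    have := Real.integral_rpow_mul_exp_neg_mul_Ioi (a := 2) (r := 1 / c) (by norm_num)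
      (by positivity)
    norm_num at this
    convert this using 1
    simp [neg_mul]
  have hInt : ∫ z : ℝ, 1 / (2 * c) * (|z| * Real.exp (-(1 / c) * |z|)) = c := by
    rw [integral_comp_abs (f := fun x => 1 / (2 * c) * (x * Real.exp (-(1 / c) * x))),
      integral_const_mul, hval]
    field_simp
  -- A non-integrable function would have integral zero by convention.
  have hI : Integrable fun z : ℝ => 1 / (2 * c) * (|z| * Real.exp (-(1 / c) * |z|)) := by
    by_contra h
    rw [integral_undef h] at hInt
    exact hc.ne hInt
  rw [laplace, lintegral_withDensity_eq_lintegral_mul _ (by fun_prop) (by fun_prop)]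
  conv_rhs => rw [← hInt]
  rw [ofReal_integral_eq_lintegral_ofReal hI (ae_of_all _ fun z => by positivity)]
  refine lintegral_congr fun z => ?_
  rw [Pi.mul_apply, ← ENNReal.ofReal_mul (by positivity)]
  congr 1
  rw [show -(1 / c) * |z| = -|z| / c by ring]
  ring

theorem measurable_l1Dist (q : ℕ → ℝ) : Measurable fun p => l1Dist p q := by
  unfold l1Dist
  exact Measurable.tsum fun k => ((measurable_pi_apply k).sub_const _).enorm

/-- There are `D + 1 ≤ 2 * D` noise terms of mean absolute value `b * D / ε`. The score already
contains `6 * D ^ 2 / ε`, so a factor `4 + b` on it covers both truncation and noise. -/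
theorem lintegral_estimateLaw_le {n : ℕ} (G : SimpleGraph (Fin n)) (hn : 0 < n) {b ε : ℝ}
    (hb : 0 < b) (hε : 0 < ε) {D : ℕ} (hD : 0 < D) :
    ∫⁻ p, l1Dist p (degDist G) ∂(estimateLaw G b ε D) ≤
      ENNReal.ofReal ((4 + b) / n * err G ε D) := by
  have hn' : (0 : ℝ) < n := by positivity
  have hD' : (1 : ℝ) ≤ D := by exact_mod_cast hD
  have hc : 0 < b * D / ε := by positivity
  have := isProbabilityMeasure_laplace hc
  rw [estimateLaw, lintegral_map (measurable_l1Dist _) (measurable_estimate G D)]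
  set A := ∑ v, |extDegList G D v - degList G v| with hA
  have hA0 : 0 ≤ A := Finset.sum_nonneg fun _ _ => abs_nonneg _
  calc _ ≤ ∫⁻ Y : Fin (D + 1) → ℝ, (ENNReal.ofReal (4 * A / n) +
        ENNReal.ofReal (2 / n) * ∑ i, ENNReal.ofReal |Y i|)
          ∂(Measure.pi fun _ : Fin (D + 1) => laplace (b * D / ε)) := by
        refine lintegral_mono fun Y => (l1Dist_estimate_le G hn Y).trans (le_of_eq ?_)
        rw [← ENNReal.ofReal_sum_of_nonneg fun _ _ => abs_nonneg _,
          ← ENNReal.ofReal_mul (by positivity), ← ENNReal.ofReal_add (by positivity)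
          (mul_nonneg (by positivity) (Finset.sum_nonneg fun _ _ => abs_nonneg _))]
        congr 1
        ring
    _ = ENNReal.ofReal (4 * A / n) + ENNReal.ofReal (2 / n) *
          ∑ i : Fin (D + 1), ENNReal.ofReal (b * D / ε) := by
        rw [lintegral_add_left measurable_const, lintegral_const_mul _ (by fun_prop),
          lintegral_finsetSum _ (by fun_prop)]
        simp only [lintegral_const, measure_univ, mul_one]
        congr 2
        refine Finset.sum_congr rfl fun i _ => ?_
        rw [← lintegral_abs_laplace hc, ← (measurePreserving_eval
          (fun _ : Fin (D + 1) => laplace (b * D / ε)) i).lintegral_comp (by fun_prop)]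
    _ = ENNReal.ofReal (4 * A / n + 2 / n * ((D + 1) * (b * D / ε))) := by
        rw [Finset.sum_const, Finset.card_univ, Fintype.card_fin, nsmul_eq_mul,
          ENNReal.ofReal_add (by positivity) (by positivity), ENNReal.ofReal_mul (by positivity),
          ENNReal.ofReal_mul (by positivity)]
        congr 3
        rw [← Nat.cast_succ, ENNReal.ofReal_natCast]
    _ ≤ _ := by
        refine ENNReal.ofReal_le_ofReal ?_
        rw [err, ← hA]
        have h1 : (D + 1) * (b * D / ε) ≤ 2 * D * (b * D / ε) := by gcongr; linarith
        have h2 : (4 + b) / n * (A + 6 * (D : ℝ) ^ 2 / ε) - (4 * A / n + 2 / n * (2 * D * (b * D / ε)))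
          = (b * A + 24 * D ^ 2 / ε + 2 * b * D ^ 2 / ε) / n := by field_simp; ring
        have h3 : 0 ≤ (b * A + 24 * D ^ 2 / ε + 2 * b * D ^ 2 / ε) / n := by positivity
        have h4 : 2 / n * ((D + 1) * (b * D / ε)) ≤ 2 / n * (2 * D * (b * D / ε)) := by gcongr
        linarith

theorem lintegral_estimateLaw_le_two {n : ℕ} (G : SimpleGraph (Fin n)) (hn : 0 < n) {b ε : ℝ}
    (hb : 0 < b) (hε : 0 < ε) {D : ℕ} (hD : 0 < D) :
    ∫⁻ p, l1Dist p (degDist G) ∂(estimateLaw G b ε D) ≤ 2 := by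
  have hD' : (0 : ℝ) < D := by exact_mod_cast hD
  have := isProbabilityMeasure_laplace (c := b * D / ε) (by positivity)
  rw [estimateLaw, lintegral_map (measurable_l1Dist _) (measurable_estimate G D)]
  calc _ ≤ ∫⁻ _ : Fin (D + 1) → ℝ, 2
          ∂(Measure.pi fun _ : Fin (D + 1) => laplace (b * D / ε)) :=
        lintegral_mono fun Y => l1Dist_estimate_le_two G hn Y
    _ = 2 := by simp

/-! ### The generalized exponential mechanism -/

/-- The index `i₀` alone makes the normalizing constant at least one. -/
theorem expMech_apply_le {ι : Type*} [Fintype ι] [Nonempty ι] (s : ι → ℝ) {ε : ℝ} (hε : 0 ≤ ε)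
    {i₀ : ι} (hi₀ : s i₀ ≤ 0) (i : ι) :
    expMech s ε i ≤ ENNReal.ofReal (Real.exp (-(ε / 2) * s i)) := by
  rw [expMech, PMF.normalize_apply]
  refine mul_le_of_le_one_right' (ENNReal.inv_le_one.2 ?_)
  refine le_trans ?_ (ENNReal.le_tsum i₀)
  rw [ENNReal.one_le_ofReal, Real.one_le_exp_iff]
  have := mul_nonneg hε (neg_nonneg.2 hi₀)
  linarith

theorem sq_mul_exp_neg_le {w : ℝ} (hw : 0 ≤ w) : w ^ 2 * Real.exp (-w) ≤ 2 := by
  rw [Real.exp_neg, ← div_eq_mul_inv, div_le_iff₀ (Real.exp_pos w)]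
  have := Real.quadratic_le_exp_of_nonneg hw
  linarith

/-- The expected score of the index chosen by the generalized exponential mechanism, when the
squares of the sensitivity bounds are controlled by the scores. -/
theorem sum_genExpMech_mul_le {ι : Type*} [Fintype ι] [Nonempty ι] (q Δ : ι → ℝ) {β ε : ℝ}
    (hβ₀ : 0 < β) (hβ₁ : β < 1) (hε : 0 < ε) (hΔ : ∀ i, 0 < Δ i)
    (hq : ∀ i, 6 * Δ i ^ 2 / ε ≤ q i) (j : ι) :
    ∑ i, genExpMech q Δ β ε i * ENNReal.ofReal (q i) ≤
      ENNReal.ofReal (6 / 5 * (q j + 2 * Real.log ((Fintype.card ι : ℝ) / β) / ε * Δ j +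
        2 * Δ j * Real.log (Fintype.card ι) / ε + Δ j ^ 2 / ε + 4 / ε)) := by
  set k : ℝ := (Fintype.card ι : ℝ) with hk
  have hk1 : 1 ≤ k := Nat.one_le_cast.2 (Fintype.card_pos (α := ι))
  have hk0 : 0 < k := zero_lt_one.trans_le hk1
  set τ := 2 * Real.log (k / β) / ε with hτ
  have hlog : 0 ≤ Real.log k := Real.log_nonneg hk1
  have hτ' : 2 * Real.log k / ε ≤ τ := by
    rw [hτ]
    gcongr
    rw [le_div_iff₀ hβ₀]
    nlinarith
  have hτ0 : 0 ≤ τ := le_trans (by positivity) hτ'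
  set s := normScore q Δ τ with hs
  have hsj : ∀ i j, ((q i + τ * Δ i) - (q j + τ * Δ j)) / (Δ i + Δ j) ≤ s i := fun i j =>
    Finset.le_sup' (fun j => ((q i + τ * Δ i) - (q j + τ * Δ j)) / (Δ i + Δ j))
      (Finset.mem_univ j)
  -- The minimizer of the penalized score has nonpositive normalized score.
  obtain ⟨i₀, hi₀⟩ := Finite.exists_min fun i => q i + τ * Δ i
  have hs0 : s i₀ ≤ 0 := Finset.sup'_le _ _ fun j _ =>
    div_nonpos_of_nonpos_of_nonneg (sub_nonpos.2 (hi₀ j)) (add_pos (hΔ _) (hΔ _)).le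
  set u : ι → ℝ := fun i => ε / 2 * s i with hu
  -- `w i` is the excess of the exponent over `log k`, the level that a union bound over `k` indices
  -- allows.
  set w : ι → ℝ := fun i => max (u i - Real.log k) 0 with hw
  set K := q j + τ * Δ j + 2 * Δ j * Real.log k / ε + Δ j ^ 2 / ε with hK
  have hw0 : ∀ i, 0 ≤ w i := fun i => le_max_right _ _
  have hq0 : ∀ i, 0 ≤ q i := fun i => le_trans (by positivity) (hq i)
  have hK0 : 0 ≤ K := by
    have := hq0 j; have := hΔ j
    positivity
  -- Bound `s i` by `2 * (log k + w i) / ε`. The penalty `τ * Δ i` absorbs the `log k` part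
  -- multiplying `Δ i`; AM-GM turns `w i * Δ i` into squares, and `Δ i ^ 2 / ε ≤ q i / 6` moves to
  -- the left, giving `6 / 5`.
  have hqi : ∀ i, q i ≤ 6 / 5 * (K + 2 * w i ^ 2 / ε) := by
    intro i
    have h1 := hsj i j
    have hi := hΔ i
    have hj := hΔ j
    rw [div_le_iff₀ (add_pos hi hj)] at h1
    have h2 : s i = 2 / ε * u i := by simp only [hu]; field_simp
    have h3 : u i ≤ Real.log k + w i := by have := le_max_left (u i - Real.log k) 0; linarith
    have h4 : s i * (Δ i + Δ j) ≤ 2 / ε * (Real.log k + w i) * (Δ i + Δ j) := by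
      rw [h2]; gcongr
    have h5 : 2 * Real.log k / ε * Δ i ≤ τ * Δ i := by gcongr
    have h6 : 2 / ε * (Real.log k + w i) * (Δ i + Δ j) = 2 * Real.log k / ε * Δ i +
        2 * Δ j * Real.log k / ε + (2 * w i * Δ i + 2 * w i * Δ j) / ε := by ring
    have h7 : (2 * w i * Δ i + 2 * w i * Δ j) / ε ≤
        ((w i ^ 2 + Δ i ^ 2) + (w i ^ 2 + Δ j ^ 2)) / ε := by
      gcongr <;> exact two_mul_le_add_sq _ _
    have h8 : ((w i ^ 2 + Δ i ^ 2) + (w i ^ 2 + Δ j ^ 2)) / ε =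
        2 * w i ^ 2 / ε + (6 * Δ i ^ 2 / ε) / 6 + Δ j ^ 2 / ε := by ring
    have h9 := hq i
    linarith
  -- For positive `w i` the weight is `exp (-w i) / k`, so the `k` indices together contribute a
  -- constant.
  have hwe : ∀ i, w i ^ 2 * Real.exp (-u i) ≤ 2 / k := by
    intro i
    rcases le_total (u i - Real.log k) 0 with h | h
    · have : w i = 0 := max_eq_right h
      rw [this]
      simp only [ne_eq, OfNat.ofNat_ne_zero, not_false_eq_true, zero_pow, zero_mul]
      positivity
    · have h1 : w i = u i - Real.log k := max_eq_left h
      have h2 : Real.exp (-u i) = Real.exp (-w i) / k := by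
        rw [h1, neg_sub, Real.exp_sub, Real.exp_log hk0, Real.exp_neg]
        field_simp
      rw [h2, ← mul_div_assoc]
      gcongr
      exact sq_mul_exp_neg_le (hw0 i)
  have hP : ∀ i, genExpMech q Δ β ε i ≤ ENNReal.ofReal (Real.exp (-u i)) := by
    intro i
    refine (expMech_apply_le _ hε.le hs0 i).trans (le_of_eq ?_)
    simp only [hu, neg_mul]
  have hP1 : ∑ i, genExpMech q Δ β ε i = 1 :=
    (tsum_fintype _).symm.trans (PMF.tsum_coe _)
  calc _ ≤ ∑ i, (genExpMech q Δ β ε i * ENNReal.ofReal (6 / 5 * K) +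
          ENNReal.ofReal (6 / 5 * (4 / ε) / k)) := by
        refine Finset.sum_le_sum fun i _ => ?_
        calc _ ≤ genExpMech q Δ β ε i *
                ENNReal.ofReal (6 / 5 * K + 6 / 5 * (2 * w i ^ 2 / ε)) := by
              rw [← mul_add]; gcongr; exact hqi i
          _ = genExpMech q Δ β ε i * ENNReal.ofReal (6 / 5 * K) +
                genExpMech q Δ β ε i * ENNReal.ofReal (6 / 5 * (2 * w i ^ 2 / ε)) := by
              rw [ENNReal.ofReal_add (by positivity) (by positivity), mul_add]
          _ ≤ _ := by
              gcongr
              calc _ ≤ ENNReal.ofReal (Real.exp (-u i)) *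
                    ENNReal.ofReal (6 / 5 * (2 * w i ^ 2 / ε)) := by gcongr; exact hP i
                _ = ENNReal.ofReal (Real.exp (-u i) * (6 / 5 * (2 * w i ^ 2 / ε))) :=
                    (ENNReal.ofReal_mul (Real.exp_pos _).le).symm
                _ ≤ _ := by
                    refine ENNReal.ofReal_le_ofReal ?_
                    have h1 : Real.exp (-u i) * (6 / 5 * (2 * w i ^ 2 / ε)) =
                        6 / 5 * (2 * (w i ^ 2 * Real.exp (-u i)) / ε) := by ring
                    have h2 : 6 / 5 * (4 / ε) / k = 6 / 5 * (2 * (2 / k) / ε) := by ring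
                    rw [h1, h2]
                    gcongr
                    exact hwe i
    _ = ENNReal.ofReal (6 / 5 * K) + ENNReal.ofReal (6 / 5 * (4 / ε)) := by
        rw [Finset.sum_add_distrib, ← Finset.sum_mul, hP1, one_mul, Finset.sum_const,
          Finset.card_univ, nsmul_eq_mul, ← ENNReal.ofReal_natCast, ← hk,
          ← ENNReal.ofReal_mul hk0.le, mul_div_cancel₀ _ hk0.ne']
    _ = _ := by
        rw [← ENNReal.ofReal_add (by positivity) (by positivity)]
        congr 1
        ring

/-! ### The expected error of the algorithm -/

theorem expectedError_eq {n : ℕ} (G : SimpleGraph (Fin n)) (b β ε : ℝ) :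
    expectedError G b β ε = ∑ i, selectThr G β ε i *
      ∫⁻ p, l1Dist p (degDist G) ∂(estimateLaw G b ε (2 ^ (i : ℕ))) := by
  rw [expectedError, comboLaw, Measure.lintegral_bind Measurable.of_discrete.aemeasurable
    (measurable_l1Dist _).aemeasurable, lintegral_fintype]
  refine Finset.sum_congr rfl fun i _ => ?_
  rw [PMF.toMeasure_apply_singleton _ _ (measurableSet_singleton i), mul_comm]

theorem expectedError_le_two {n : ℕ} (G : SimpleGraph (Fin n)) (hn : 0 < n) {b ε : ℝ} (β : ℝ)
    (hb : 0 < b) (hε : 0 < ε) : expectedError G b β ε ≤ 2 := by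
  have hP1 : ∑ i, selectThr G β ε i = 1 :=
    (tsum_fintype _).symm.trans (PMF.tsum_coe _)
  rw [expectedError_eq, ← one_mul (2 : ℝ≥0∞), ← hP1, Finset.sum_mul]
  gcongr with i
  exact lintegral_estimateLaw_le_two G hn hb hε (by positivity)

/-- As thresholds are at least one, the terms `Δ ^ 2 / ε`, `1 / ε` and `log (1 / β) * Δ / ε` of the
selection bound are absorbed by the score through its part `6 * Δ ^ 2 / ε`; only `Δ * log k / ε`
survives. -/
theorem expectedError_le {n : ℕ} (G : SimpleGraph (Fin n)) (hn : 0 < n) {b β ε : ℝ} (hb : 0 < b)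
    (hβ₀ : 0 < β) (hβ₁ : β < 1) (hε : 0 < ε) {j : ℕ} (hj : j < numThr n) :
    expectedError G b β ε ≤ ENNReal.ofReal ((4 + b) / n * (5 * (1 + Real.log (1 / β)) *
      (err G ε (2 ^ j) + 2 ^ j * Real.log (numThr n) / ε))) := by
  have hn' : (0 : ℝ) < n := by positivity
  have hk0 : (0 : ℝ) < numThr n := by positivity
  have hk : 0 ≤ Real.log (numThr n) := Real.log_nonneg (by simp)
  have hl : 0 ≤ Real.log (1 / β) := Real.log_nonneg (by rw [le_div_iff₀ hβ₀]; linarith)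
  have hq : ∀ i : Fin (numThr n), 6 * ((2 : ℝ) ^ (i : ℕ)) ^ 2 / ε ≤ err G ε (2 ^ (i : ℕ)) := by
    intro i
    rw [err]
    push_cast
    exact le_add_of_nonneg_left (Finset.sum_nonneg fun _ _ => abs_nonneg _)
  have key := sum_genExpMech_mul_le (fun i : Fin (numThr n) => err G ε (2 ^ (i : ℕ)))
    (fun i => (2 : ℝ) ^ (i : ℕ)) hβ₀ hβ₁ hε (fun i => by positivity) hq ⟨j, hj⟩
  rw [Fintype.card_fin] at key
  rw [expectedError_eq]
  calc _ ≤ ∑ i, selectThr G β ε i *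
          ENNReal.ofReal ((4 + b) / n * err G ε (2 ^ (i : ℕ))) := by
        gcongr with i
        exact lintegral_estimateLaw_le G hn hb hε (by positivity)
    _ = ENNReal.ofReal ((4 + b) / n) *
          ∑ i, selectThr G β ε i * ENNReal.ofReal (err G ε (2 ^ (i : ℕ))) := by
        rw [Finset.mul_sum]
        refine Finset.sum_congr rfl fun i _ => ?_
        rw [ENNReal.ofReal_mul (by positivity)]
        ring
    _ ≤ _ := by
        rw [ENNReal.ofReal_mul (by positivity : 0 ≤ (4 + b) / n)]
        gcongr
        refine key.trans (ENNReal.ofReal_le_ofReal ?_)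
        have hqj := hq ⟨j, hj⟩
        simp only at hqj ⊢
        set Δ : ℝ := 2 ^ j with hΔ
        set Q := err G ε (2 ^ j) with hQ
        have hΔ1 : 1 ≤ Δ := one_le_pow₀ (by norm_num)
        have h1 : Real.log (numThr n / β) = Real.log (numThr n) + Real.log (1 / β) := by
          rw [← Real.log_mul hk0.ne' (by positivity)]
          congr 1
          ring
        rw [h1]
        set l := Real.log (1 / β)
        set m := Real.log (numThr n)
        have h2 : 1 / ε ≤ Q / 6 := by
          refine le_trans ?_ (div_le_div_of_nonneg_right hqj (by norm_num))
          rw [show 6 * Δ ^ 2 / ε / 6 = Δ ^ 2 / ε by ring]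
          gcongr
          exact one_le_pow₀ hΔ1
        have h3 : Δ ^ 2 / ε ≤ Q / 6 := by
          have : 6 * Δ ^ 2 / ε / 6 = Δ ^ 2 / ε := by ring
          linarith
        have h4 : Δ / ε ≤ Δ ^ 2 / ε := by gcongr; nlinarith
        have h5 : l * (Δ / ε) ≤ l * (Q / 6) :=
          mul_le_mul_of_nonneg_left (h4.trans h3) hl
        have h6 : 0 ≤ l * Q := by
          have : 0 ≤ Q := le_trans (by positivity) hqj
          positivity
        have h7 : 0 ≤ Δ * m / ε := by positivity
        have h8 : 0 ≤ l * (Δ * m / ε) := by positivity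
        have h9 : 0 ≤ Q := le_trans (by positivity) hqj
        have e1 : 2 * (m + l) / ε * Δ = 2 * (Δ * m / ε) + 2 * (l * (Δ / ε)) := by ring
        have e2 : 2 * Δ * m / ε = 2 * (Δ * m / ε) := by ring
        have e3 : 4 / ε = 4 * (1 / ε) := by ring
        rw [e1, e2, e3]
        have e4 : 5 * (1 + l) * (Q + Δ * m / ε) =
            5 * Q + 5 * (Δ * m / ε) + 5 * (l * Q) + 5 * (l * (Δ * m / ε)) := by ring
        rw [e4]
        linarith

/-! ### Consequences of `α`-decay -/

/-- Comparison with the integral of `x ^ (-α)` over `[D, N]`. -/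
theorem sum_Ioc_rpow_neg_le {α : ℝ} (hα : 1 < α) {D : ℕ} (hD : 1 ≤ D) (N : ℕ) :
    ∑ k ∈ Finset.Ioc D N, (k : ℝ) ^ (-α) ≤ (D : ℝ) ^ (1 - α) / (α - 1) := by
  have hD' : (0 : ℝ) < D := by exact_mod_cast hD
  rcases lt_or_ge N D with h | h
  · rw [Finset.Ioc_eq_empty_of_le h.le, Finset.sum_empty]
    have : 0 < α - 1 := by linarith
    positivity
  have hanti : AntitoneOn (fun x : ℝ => x ^ (-α)) (Set.Icc D N) := by
    intro x hx y hy hxy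
    exact Real.rpow_le_rpow_of_nonpos (hD'.trans_le hx.1) hxy (by linarith)
  have h1 := hanti.sum_le_integral_Ico h
  have h2 : (0 : ℝ) ∉ Set.uIcc (D : ℝ) N := by
    rw [Set.uIcc_of_le (by exact_mod_cast h)]
    exact fun hx => absurd hx.1 (not_le.2 hD')
  rw [integral_rpow (Or.inr ⟨by linarith, h2⟩)] at h1
  have h3 : ∑ k ∈ Finset.Ioc D N, (k : ℝ) ^ (-α) =
      ∑ i ∈ Finset.Ico D N, ((i + 1 : ℕ) : ℝ) ^ (-α) := by
    rw [Finset.sum_Ico_add' (fun k : ℕ => (k : ℝ) ^ (-α)) D N 1]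
    refine Finset.sum_congr ?_ fun _ _ => rfl
    ext k
    simp only [Finset.mem_Ioc, Finset.mem_Ico]
    omega
  rw [h3]
  refine h1.trans ?_
  rw [← neg_div_neg_eq, show -(-α + 1) = α - 1 by ring, show -α + 1 = 1 - α by ring]
  have : (0 : ℝ) ≤ (N : ℝ) ^ (1 - α) := by positivity
  have : 0 < α - 1 := by linarith
  gcongr
  linarith

theorem sum_max_deg_sub {n : ℕ} (G : SimpleGraph (Fin n)) (D : ℕ) :
    ∑ v, max ((deg G v : ℝ) - D) 0 = ∑ k ∈ Finset.Ioc D n, n * cumDist G k := by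
  rcases n.eq_zero_or_pos with rfl | hn
  · simp
  have hn' : (n : ℝ) ≠ 0 := by positivity
  have h1 : ∀ v, max ((deg G v : ℝ) - D) 0 =
      ∑ k ∈ Finset.Ioc D n, if k ≤ deg G v then (1 : ℝ) else 0 := by
    intro v
    rw [Finset.sum_boole]
    have : (Finset.Ioc D n).filter (fun k => k ≤ deg G v) = Finset.Ioc D (deg G v) := by
      have := deg_lt G v
      ext k
      simp only [Finset.mem_filter, Finset.mem_Ioc]
      omega
    rw [this, Nat.card_Ioc]
    rcases le_total D (deg G v) with h | h
    · rw [Nat.cast_sub h, max_eq_left (sub_nonneg.2 (by exact_mod_cast h))]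
    · rw [Nat.sub_eq_zero_of_le h, Nat.cast_zero,
        max_eq_right (sub_nonpos.2 (by exact_mod_cast h))]
  simp only [h1]
  rw [Finset.sum_comm]
  refine Finset.sum_congr rfl fun k _ => ?_
  rw [cumDist, mul_div_cancel₀ _ hn', Finset.sum_boole]
  simp only [Nat.cast_le]

theorem mul_avgDeg {n : ℕ} (G : SimpleGraph (Fin n)) (hn : 0 < n) :
    n * avgDeg G = ∑ v, (deg G v : ℝ) := by
  classical
  have hn' : (n : ℝ) ≠ 0 := by positivity
  rw [avgDeg, mul_div_cancel₀ _ hn']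
  have := G.sum_degrees_eq_twice_card_edges
  have h2 : ∑ v, deg G v = 2 * G.edgeFinset.card := by
    rw [← this]
    refine Finset.sum_congr rfl fun v _ => ?_
    unfold deg
    congr!
  rw [← Nat.cast_sum, h2]
  push_cast
  congr!

/-- With average zero the level `2 * Av` would be zero, which every degree reaches, against decay at
`t = 2`. -/
theorem AlphaDecay.avgDeg_pos {n : ℕ} {α : ℝ} (hα : 1 < α) {G : SimpleGraph (Fin n)}
    (hn : 0 < n) (h : AlphaDecay α G) : 0 < avgDeg G := by
  have h0 : 0 ≤ avgDeg G := by unfold avgDeg; positivity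
  refine lt_of_le_of_ne h0 fun he => ?_
  have h2 := h 2 (by norm_num)
  have hn' : (n : ℝ) ≠ 0 := by positivity
  rw [← he, mul_zero] at h2
  have h3 : cumDist G 0 = 1 := by
    simp [cumDist, hn']
  rw [h3] at h2
  have := Real.rpow_lt_one_of_one_lt_of_neg (x := 2) (z := -α) (by norm_num) (by linarith)
  linarith

theorem AlphaDecay.cumDist_le {n : ℕ} {α : ℝ} {G : SimpleGraph (Fin n)} (h : AlphaDecay α G)
    (h0 : 0 < avgDeg G) {x : ℝ} (hx : avgDeg G < x) :
    cumDist G x ≤ avgDeg G ^ α * x ^ (-α) := by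
  have h1 := h (x / avgDeg G) (by rwa [one_lt_div h0])
  rw [div_mul_cancel₀ _ h0.ne', Real.div_rpow (h0.trans hx).le h0.le, Real.rpow_neg h0.le,
    div_inv_eq_mul, mul_comm] at h1
  exact h1

theorem AlphaDecay.sum_max_deg_sub_le {n : ℕ} {α : ℝ} (hα : 1 < α) {G : SimpleGraph (Fin n)}
    (h : AlphaDecay α G) (h0 : 0 < avgDeg G) {D : ℕ} (hD : 1 ≤ D) (hDA : avgDeg G ≤ D) :
    ∑ v, max ((deg G v : ℝ) - D) 0 ≤
      n * (avgDeg G ^ α * ((D : ℝ) ^ (1 - α) / (α - 1))) := by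
  rw [sum_max_deg_sub, ← Finset.mul_sum]
  gcongr
  calc _ ≤ ∑ k ∈ Finset.Ioc D n, avgDeg G ^ α * (k : ℝ) ^ (-α) := by
        refine Finset.sum_le_sum fun k hk => h.cumDist_le h0 (hDA.trans_lt ?_)
        exact_mod_cast (Finset.mem_Ioc.1 hk).1
    _ ≤ _ := by
        rw [← Finset.mul_sum]
        gcongr
        exact sum_Ioc_rpow_neg_le hα hD n

/-- Graphs with `α`-decay have average degree bounded away from zero. -/
theorem AlphaDecay.le_avgDeg {n : ℕ} {α : ℝ} (hα : 1 < α) {G : SimpleGraph (Fin n)}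
    (hn : 0 < n) (h : AlphaDecay α G) : ((α - 1) / α) ^ (1 / (α - 1)) ≤ avgDeg G := by
  have hα1 : 0 < α - 1 := by linarith
  have hn' : (0 : ℝ) < n := by positivity
  have h0 := h.avgDeg_pos hα hn
  have hle1 : (α - 1) / α ≤ 1 := by rw [div_le_one (by linarith)]; linarith
  have hc0 : 0 < (α - 1) / α := by positivity
  rcases lt_or_ge (avgDeg G) 1 with hA | hA
  swap
  · exact (Real.rpow_le_one hc0.le hle1 (by positivity)).trans hA
  have h1 : avgDeg G = ∑ k ∈ Finset.Ioc 0 n, cumDist G k := by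
    have := sum_max_deg_sub G 0
    simp only [Nat.cast_zero, sub_zero, Nat.cast_nonneg, sup_of_le_left] at this
    rw [← mul_avgDeg G hn, ← Finset.mul_sum] at this
    exact mul_left_cancel₀ hn'.ne' this
  -- Since the average is below one, decay applies at every `k ≥ 1`; the term `k = 1` is split off
  -- to give `1 + 1 / (α - 1)`.
  have h2 : avgDeg G ≤ avgDeg G ^ α * (α / (α - 1)) := by
    calc avgDeg G ≤ ∑ k ∈ Finset.Ioc 0 n, avgDeg G ^ α * (k : ℝ) ^ (-α) := by
          refine h1.le.trans (Finset.sum_le_sum fun k hk => h.cumDist_le h0 (hA.trans_le ?_))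
          exact_mod_cast (Finset.mem_Ioc.1 hk).1
      _ ≤ _ := by
          rw [← Finset.mul_sum]
          gcongr
          rw [← Finset.sum_Ioc_consecutive _ zero_le_one hn]
          have := sum_Ioc_rpow_neg_le hα le_rfl n
          rw [Nat.cast_one, Real.one_rpow] at this
          have e : α / (α - 1) = 1 + 1 / (α - 1) := by field_simp; ring
          rw [e]
          refine add_le_add (le_of_eq ((Finset.sum_singleton _ _).trans ?_)) this
          rw [Nat.cast_one, Real.one_rpow]
  have h3 : (α - 1) / α ≤ avgDeg G ^ (α - 1) := by
    rw [Real.rpow_sub h0, Real.rpow_one, div_le_div_iff₀ (by linarith) h0]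
    rw [← mul_div_assoc, le_div_iff₀ hα1] at h2
    linarith
  rw [one_div]
  exact (Real.rpow_inv_le_iff_of_pos hc0.le h0.le hα1).2 h3

/-! ### Iterated logarithms -/

theorem log_log_three_pos : 0 < Real.log (Real.log 3) := by
  refine Real.log_pos ?_
  rw [Real.lt_log_iff_exp_lt (by norm_num)]
  exact Real.exp_one_lt_d9.trans (by norm_num)

theorem log_log_mono {n : ℕ} (hn : 3 ≤ n) :
    Real.log (Real.log 3) ≤ Real.log (Real.log n) := by
  have : (3 : ℝ) ≤ n := by exact_mod_cast hn
  have h3 : 0 < Real.log 3 := Real.log_pos (by norm_num)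
  gcongr

/-- The number of thresholds is at most `3 * log n`. The additive `log 3` is absorbed because `ln ln
n ≥ ln ln 3 > 0` for `n ≥ 3`. -/
theorem log_numThr_le {n : ℕ} (hn : 3 ≤ n) : Real.log (numThr n) ≤
    (1 + Real.log 3 / Real.log (Real.log 3)) * Real.log (Real.log n) := by
  have hn' : (3 : ℝ) ≤ n := by exact_mod_cast hn
  have hl1 : 1 ≤ Real.log n := by
    rw [Real.le_log_iff_exp_le (by linarith)]
    exact (Real.exp_one_lt_d9.le.trans (by norm_num)).trans hn'
  have h1 : (numThr n : ℝ) ≤ 3 * Real.log n := by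
    have h2 : ((Nat.log 2 n : ℕ) : ℝ) ≤ Real.log n / Real.log 2 := by
      rw [le_div_iff₀ (Real.log_pos (by norm_num)), ← Real.log_pow]
      refine Real.log_le_log (by positivity) ?_
      exact_mod_cast Nat.pow_log_le_self 2 (by omega)
    have h3 : Real.log n / Real.log 2 ≤ 2 * Real.log n := by
      rw [div_le_iff₀ (Real.log_pos (by norm_num))]
      nlinarith [Real.log_two_gt_d9]
    push_cast
    linarith
  have h4 : Real.log 3 ≤ Real.log 3 / Real.log (Real.log 3) * Real.log (Real.log n) := by
    rw [div_mul_eq_mul_div, le_div_iff₀ log_log_three_pos]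
    have : 0 < Real.log 3 := Real.log_pos (by norm_num)
    gcongr
  calc Real.log (numThr n) ≤ Real.log (3 * Real.log n) := by
        refine Real.log_le_log (by positivity) h1
    _ = Real.log 3 + Real.log (Real.log n) := Real.log_mul (by norm_num) (by linarith)
    _ ≤ _ := by linarith

/-! ### The error bound -/

/-- The threshold balancing the truncation error and the noise, for average degree `A` and
`N = ε * n`. -/
noncomputable def balancedThr (α A N : ℝ) : ℝ := (N * A ^ α) ^ (1 / (α + 1))

section balancedThr

variable {α A N : ℝ}

theorem balancedThr_pos (hA : 0 < A) (hN : 0 < N) : 0 < balancedThr α A N := by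
  unfold balancedThr; positivity

theorem balancedThr_sq_div (hα : 1 < α) (hA : 0 < A) (hN : 0 < N) :
    balancedThr α A N ^ 2 / N = A ^ (2 * α / (α + 1)) / N ^ ((α - 1) / (α + 1)) := by
  have h1 : α + 1 ≠ 0 := by linarith
  rw [balancedThr, ← Real.rpow_natCast, ← Real.rpow_mul (by positivity),
    Real.mul_rpow hN.le (by positivity), ← Real.rpow_mul hA.le]
  have e1 : α * (1 / (α + 1) * (2 : ℕ)) = 2 * α / (α + 1) := by push_cast; ring
  have e2 : 1 / (α + 1) * ((2 : ℕ) : ℝ) = 1 - (α - 1) / (α + 1) := by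
    push_cast; field_simp; ring
  rw [e1, e2, Real.rpow_sub hN, Real.rpow_one]
  field_simp

theorem balancedThr_sq_div_eq_rpow (hα : 1 < α) (hA : 0 < A) (hN : 0 < N) :
    balancedThr α A N ^ 2 / N = (A ^ (2 * α / (α - 1)) / N) ^ ((α - 1) / (α + 1)) := by
  have h1 : α + 1 ≠ 0 := by linarith
  have h2 : α - 1 ≠ 0 := by linarith
  rw [balancedThr_sq_div hα hA hN, Real.div_rpow (by positivity) hN.le, ← Real.rpow_mul hA.le]
  congr 2
  field_simp

/-- The balance equation `x ^ (α + 1) = N * A ^ α`: noise and truncation error per vertex agree at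
`x`. -/
theorem balancedThr_sq_div_eq_mul (hα : 1 < α) (hA : 0 < A) (hN : 0 < N) :
    balancedThr α A N ^ 2 / N = A ^ α * balancedThr α A N ^ (1 - α) := by
  have hx := balancedThr_pos (α := α) hA hN
  have h1 : balancedThr α A N ^ (α + 1) = N * A ^ α := by
    rw [balancedThr, ← Real.rpow_mul (by positivity), one_div_mul_cancel (by linarith),
      Real.rpow_one]
  have h2 : balancedThr α A N ^ 2 = balancedThr α A N ^ (α + 1) * balancedThr α A N ^ (1 - α) := by
    rw [← Real.rpow_add hx, ← Real.rpow_natCast]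
    congr 1
    push_cast
    ring
  rw [h2, h1]
  field_simp

end balancedThr

/-- A power of two which is within a factor of two below `x`. -/
theorem exists_pow_two_le {n : ℕ} {x : ℝ} (h1 : 1 ≤ x) (hxn : x ≤ n) :
    ∃ j < numThr n, (2 : ℝ) ^ j ≤ x ∧ x / 2 ≤ 2 ^ j := by
  have hf : 1 ≤ ⌊x⌋₊ := Nat.le_floor (by exact_mod_cast h1)
  have hfx : (⌊x⌋₊ : ℝ) ≤ x := Nat.floor_le (by linarith)
  refine ⟨Nat.log 2 ⌊x⌋₊, Nat.lt_succ_of_le (Nat.log_mono_right (Nat.floor_le_of_le hxn)), ?_, ?_⟩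
  · refine le_trans ?_ hfx
    exact_mod_cast Nat.pow_log_le_self 2 (by omega)
  · have h2 : ⌊x⌋₊ + 1 ≤ 2 ^ (Nat.log 2 ⌊x⌋₊ + 1) := Nat.lt_pow_succ_log_self one_lt_two _
    have h3 : (⌊x⌋₊ : ℝ) + 1 ≤ 2 ^ (Nat.log 2 ⌊x⌋₊ + 1) := by exact_mod_cast h2
    have h4 := Nat.lt_floor_add_one x
    rw [pow_succ] at h3
    linarith

/-- Rounding `x` down by at most a factor two costs `2 ^ (α - 1)` in the truncation error; the other
two is the one from the cut bound. -/
theorem AlphaDecay.err_le {n : ℕ} {α : ℝ} (hα : 1 < α) {G : SimpleGraph (Fin n)}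
    (h : AlphaDecay α G) (h0 : 0 < avgDeg G) {ε x : ℝ} (hε : 0 < ε) {D : ℕ} (hD : 1 ≤ D)
    (hDA : avgDeg G ≤ D) (hx : 0 < x) (hDx : D ≤ x) (hxD : x / 2 ≤ D) :
    err G ε D ≤ n * (avgDeg G ^ α * x ^ (1 - α)) * (2 ^ α / (α - 1)) + 6 * x ^ 2 / ε := by
  have hα1 : 0 < α - 1 := by linarith
  have h1 := sum_abs_extDegList_sub_le G D
  have h2 := h.sum_max_deg_sub_le hα h0 hD hDA
  have h3 : (D : ℝ) ^ (1 - α) ≤ x ^ (1 - α) * (2 ^ α / 2) := by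
    calc (D : ℝ) ^ (1 - α) ≤ (x / 2) ^ (1 - α) :=
          Real.rpow_le_rpow_of_nonpos (by positivity) hxD (by linarith)
      _ = _ := by
          rw [Real.div_rpow hx.le zero_le_two, Real.rpow_sub zero_lt_two, Real.rpow_one]
          field_simp
  have h4 : n * (avgDeg G ^ α * ((D : ℝ) ^ (1 - α) / (α - 1))) ≤
      n * (avgDeg G ^ α * (x ^ (1 - α) * (2 ^ α / 2) / (α - 1))) := by gcongr
  have h5 : 6 * (D : ℝ) ^ 2 / ε ≤ 6 * x ^ 2 / ε := by gcongr
  rw [err]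
  calc _ ≤ 2 * (n * (avgDeg G ^ α * (x ^ (1 - α) * (2 ^ α / 2) / (α - 1)))) + 6 * x ^ 2 / ε := by
        linarith
    _ = _ := by ring

/-- Decay is usable at the rounded threshold when `x > 2 * Av`, and a candidate within a factor two
exists when `1 < x < n`. If one of these fails, the rate is at least `c`, by the lower bound `a` on
the average degree or by `ε ≤ n`. -/
theorem exists_expectedError_le {α β b : ℝ} (hα : 1 < α) (hβ₀ : 0 < β) (hβ₁ : β < 1)
    (hb : 0 < b) : ∃ C c : ℝ, 0 ≤ C ∧ 0 < c ∧
      ∀ (n : ℕ) (ε : ℝ) (G : SimpleGraph (Fin n)), 3 ≤ n → 0 < ε → ε ≤ n → AlphaDecay α G →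
        c ≤ balancedThr α (avgDeg G) (ε * n) ^ 2 / (ε * n) ∨
        (1 ≤ balancedThr α (avgDeg G) (ε * n) ∧ expectedError G b β ε ≤ ENNReal.ofReal
          (C * (balancedThr α (avgDeg G) (ε * n) ^ 2 / (ε * n) +
            balancedThr α (avgDeg G) (ε * n) * Real.log (Real.log n) / (ε * n)))) := by
  have hα1 : 0 < α - 1 := by linarith
  have hα0 : 0 < α := by linarith
  have hl : 0 ≤ Real.log (1 / β) := Real.log_nonneg (by rw [le_div_iff₀ hβ₀]; linarith)
  set a := ((α - 1) / α) ^ (1 / (α - 1)) with ha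
  have ha0 : 0 < a := by positivity
  set K := 1 + Real.log 3 / Real.log (Real.log 3) with hK
  have hK0 : 0 < K := by
    have := log_log_three_pos
    have : 0 < Real.log 3 := Real.log_pos (by norm_num)
    positivity
  refine ⟨(4 + b) * (5 * (1 + Real.log (1 / β))) * (2 ^ α / (α - 1) + 6 + K),
    min 1 (min (a ^ α) (a * 2 ^ (1 - α))), by positivity, by positivity, ?_⟩
  intro n ε G hn hε hεn hG
  have hn0 : 0 < n := by omega
  have hn' : (0 : ℝ) < n := by positivity
  have hA := hG.avgDeg_pos hα hn0
  have haA : a ≤ avgDeg G := hG.le_avgDeg hα hn0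
  have hN : 0 < ε * n := by positivity
  have hL : 0 < Real.log (Real.log n) := log_log_three_pos.trans_le (log_log_mono hn)
  have hx0 : 0 < balancedThr α (avgDeg G) (ε * n) := balancedThr_pos hA hN
  have hB := balancedThr_sq_div_eq_mul hα hA hN
  set A := avgDeg G
  set x := balancedThr α A (ε * n)
  set L := Real.log (Real.log n)
  by_cases h1 : x ≤ 1
  · refine Or.inl ((min_le_right _ _).trans ((min_le_left _ _).trans ?_))
    rw [hB]
    have : 1 ≤ x ^ (1 - α) := Real.one_le_rpow_of_pos_of_le_one_of_nonpos hx0 h1 (by linarith)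
    calc a ^ α ≤ A ^ α * 1 := by rw [mul_one]; gcongr
      _ ≤ _ := by gcongr
  by_cases h2 : x ≤ 2 * A
  · refine Or.inl ((min_le_right _ _).trans ((min_le_right _ _).trans ?_))
    rw [hB]
    -- The exponent `1 - α` is negative, so replacing `x` by the larger `2 * A` lowers the rate, to
    -- `A * 2 ^ (1 - α)`.
    calc a * 2 ^ (1 - α) ≤ A * 2 ^ (1 - α) := by gcongr
      _ = A ^ α * (2 * A) ^ (1 - α) := by
          rw [Real.mul_rpow zero_le_two hA.le, mul_left_comm, ← Real.rpow_add hA,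
            add_sub_cancel, Real.rpow_one, mul_comm]
      _ ≤ _ := by
          gcongr ?_ * ?_
          exact Real.rpow_le_rpow_of_nonpos hx0 h2 (by linarith)
  -- Here `ε ≤ n` gives `ε * n ≤ x ^ 2`.
  by_cases h3 : (n : ℝ) ≤ x
  · refine Or.inl ((min_le_left _ _).trans ?_)
    rw [one_le_div hN, sq]
    gcongr
    exact hεn.trans h3
  push Not at h1 h2 h3
  refine Or.inr ⟨h1.le, ?_⟩
  obtain ⟨j, hj, hjx, hxj⟩ := exists_pow_two_le h1.le h3.le
  refine (expectedError_le G hn0 hb hβ₀ hβ₁ hε hj).trans (ENNReal.ofReal_le_ofReal ?_)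
  have he := hG.err_le hα hA hε (D := 2 ^ j) (x := x) Nat.one_le_two_pow
    (by push_cast; linarith) hx0 (by push_cast; exact hjx) (by push_cast; exact hxj)
  rw [← hB] at he
  have hk : (2 : ℝ) ^ j * Real.log (numThr n) / ε ≤ x * (K * L) / ε := by
    have := log_numThr_le hn
    have h0 : 0 ≤ Real.log (numThr n) := Real.log_nonneg (by simp)
    gcongr
  have e1 : 6 * x ^ 2 / ε = n * (6 * (x ^ 2 / (ε * n))) := by field_simp
  have e2 : x * (K * L) / ε = n * (K * (x * L / (ε * n))) := by field_simp
  rw [e1] at he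
  rw [e2] at hk
  set B := x ^ 2 / (ε * n)
  set F := x * L / (ε * n)
  have hB0 : 0 ≤ B := by positivity
  have hF0 : 0 ≤ F := by positivity
  set M := (2 : ℝ) ^ α / (α - 1)
  have hM0 : 0 ≤ M := by positivity
  calc _ ≤ (4 + b) / n * (5 * (1 + Real.log (1 / β)) *
          (n * ((M + 6 + K) * (B + F)))) := by
        gcongr
        have e3 : n * ((M + 6 + K) * (B + F)) = (n * B * M + n * (6 * B)) + n * (K * F) +
          n * ((M + 6) * F + K * B) := by ring
        have h4 : 0 ≤ n * ((M + 6) * F + K * B) := by positivity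
        linarith
    _ = _ := by field_simp

end NodeDP

/-! ### Uniform and asymptotic error bounds -/

theorem mainTheorem8 (α β b : ℝ) (hα : 1 < α) (hβ₀ : 0 < β) (hβ₁ : β < 1) (hb : 0 < b) :
    (∃ C : ℝ, ∀ (n : ℕ) (ε : ℝ) (G : SimpleGraph (Fin n)),
        3 ≤ n → 0 < ε → ε ≤ n → NodeDP.AlphaDecay α G →
        NodeDP.expectedError G b β ε ≤
          ENNReal.ofReal (C * (NodeDP.avgDeg G ^ (2 * α / (α + 1)) * Real.log (Real.log n) /
            (ε * n) ^ ((α - 1) / (α + 1))))) ∧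
    (∀ (n : ℕ → ℕ) (ε : ℕ → ℝ) (G : ∀ m, SimpleGraph (Fin (n m))),
        Tendsto n atTop atTop → (∀ m, 0 < ε m) → (∀ᶠ m in atTop, ε m ≤ n m) →
        (fun m => Real.log (Real.log (n m)) ^ 2) =O[atTop] (fun m => ε m * n m) →
        (∀ m, NodeDP.AlphaDecay α (G m)) →
        (fun m => NodeDP.avgDeg (G m) ^ (2 * α / (α - 1))) =o[atTop] (fun m => ε m * n m) →
        Tendsto (fun m => NodeDP.expectedError (G m) b β (ε m)) atTop (𝓝 0)) := by
  obtain ⟨C, c, hC, hc, key⟩ := NodeDP.exists_expectedError_le hα hβ₀ hβ₁ hb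
  constructor
  · have hL3 := NodeDP.log_log_three_pos
    set L₃ := Real.log (Real.log 3)
    -- The first summand pays for the trivial bound 2 when the rate is at least `c`; in the second,
    -- `1 / L₃` supplies the missing factor `ln ln n` and `1` covers the selection term.
    refine ⟨2 / (c * L₃) + C * (1 / L₃ + 1), fun n ε G hn hε hεn hG => ?_⟩
    have hn0 : 0 < n := by omega
    have hn' : (0 : ℝ) < n := by positivity
    have hN : 0 < ε * n := by positivity
    have hA := hG.avgDeg_pos hα hn0
    have hL : L₃ ≤ Real.log (Real.log n) := NodeDP.log_log_mono hn
    rw [mul_div_right_comm, ← NodeDP.balancedThr_sq_div hα hA hN]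
    have hk := key n ε G hn hε hεn hG
    have hx0 : 0 < NodeDP.balancedThr α (NodeDP.avgDeg G) (ε * n) := NodeDP.balancedThr_pos hA hN
    set x := NodeDP.balancedThr α (NodeDP.avgDeg G) (ε * n)
    set L := Real.log (Real.log n)
    have hL0 : 0 < L := hL3.trans_le hL
    have hB0 : 0 < x ^ 2 / (ε * n) := by positivity
    rw [add_mul]
    rcases hk with h | ⟨h1, h⟩
    · refine (NodeDP.expectedError_le_two G hn0 β hb hε).trans ?_
      rw [← ENNReal.ofReal_ofNat]
      refine ENNReal.ofReal_le_ofReal ?_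
      have h2 : c * L₃ ≤ x ^ 2 / (ε * n) * L := by gcongr
      have h3 : 2 ≤ 2 / (c * L₃) * (x ^ 2 / (ε * n) * L) := by
        rw [div_mul_eq_mul_div, le_div_iff₀ (by positivity)]
        linarith
      have h4 : 0 ≤ C * (1 / L₃ + 1) * (x ^ 2 / (ε * n) * L) := by positivity
      linarith
    · refine h.trans (ENNReal.ofReal_le_ofReal ?_)
      have h2 : x * L / (ε * n) ≤ x ^ 2 / (ε * n) * L := by
        rw [← mul_div_right_comm]
        gcongr
        nlinarith
      have h3 : x ^ 2 / (ε * n) ≤ 1 / L₃ * (x ^ 2 / (ε * n) * L) := by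
        rw [one_div_mul_eq_div, le_div_iff₀ hL3]
        gcongr
      have h4 : 0 ≤ 2 / (c * L₃) * (x ^ 2 / (ε * n) * L) := by positivity
      calc _ ≤ C * (1 / L₃ * (x ^ 2 / (ε * n) * L) + x ^ 2 / (ε * n) * L) := by gcongr
        _ = C * (1 / L₃ + 1) * (x ^ 2 / (ε * n) * L) := by ring
        _ ≤ _ := by linarith
  · intro n ε G hn hε hεn hO hG ho
    have hn3 : ∀ᶠ m in atTop, 3 ≤ n m := hn.eventually_ge_atTop 3
    have hB : Tendsto (fun m => NodeDP.balancedThr α (NodeDP.avgDeg (G m)) (ε m * n m) ^ 2 /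
        (ε m * n m)) atTop (𝓝 0) := by
      have hp : 0 < (α - 1) / (α + 1) := div_pos (by linarith) (by linarith)
      have h1 := ho.tendsto_div_nhds_zero.rpow_const (p := (α - 1) / (α + 1)) (Or.inr hp.le)
      rw [Real.zero_rpow hp.ne'] at h1
      refine h1.congr' ?_
      filter_upwards [hn3] with m hm
      have hn' : (0 : ℝ) < n m := by exact_mod_cast (by omega : 0 < n m)
      exact (NodeDP.balancedThr_sq_div_eq_rpow hα ((hG m).avgDeg_pos hα (by omega))
        (mul_pos (hε m) hn')).symm
    obtain ⟨K, hK0, hK⟩ := hO.exists_pos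
    have hlim : Tendsto (fun m => ENNReal.ofReal
        (C * (NodeDP.balancedThr α (NodeDP.avgDeg (G m)) (ε m * n m) ^ 2 / (ε m * n m) +
          √(NodeDP.balancedThr α (NodeDP.avgDeg (G m)) (ε m * n m) ^ 2 / (ε m * n m) * K))))
        atTop (𝓝 0) := by
      have h1 := (hB.add (hB.mul_const K).sqrt).const_mul C
      simpa using ENNReal.tendsto_ofReal h1
    refine tendsto_of_tendsto_of_tendsto_of_le_of_le' tendsto_const_nhds hlim
      (Eventually.of_forall fun _ => zero_le) ?_
    filter_upwards [hn3, hεn, hB.eventually_lt_const hc, hK.bound] with m hm hεm hBm hKm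
    rcases key (n m) (ε m) (G m) hm (hε m) hεm (hG m) with h | ⟨-, h⟩
    · exact absurd h (not_le.2 hBm)
    refine h.trans (ENNReal.ofReal_le_ofReal ?_)
    have hn' : (0 : ℝ) < n m := by exact_mod_cast (by omega : 0 < n m)
    have hN : 0 < ε m * n m := mul_pos (hε m) hn'
    rw [Real.norm_of_nonneg (sq_nonneg _), Real.norm_of_nonneg hN.le] at hKm
    gcongr
    refine Real.le_sqrt_of_sq_le ?_
    set x := NodeDP.balancedThr α (NodeDP.avgDeg (G m)) (ε m * n m)
    rw [div_pow, mul_pow, div_le_iff₀ (by positivity)]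
    calc _ ≤ x ^ 2 * (K * (ε m * n m)) := by gcongr
      _ = _ := by field_simp
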